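/- All transfer functions are matrices of complex rational functions of $s$; $M^\dagger$ is the conjugate transpose of a matrix, $F(s)^H:=F(-s^*)^\dagger$, and $\bar{\mathbf R}=\mathbf R\cup\{\pm\infty\}$, values at $\pm\infty$ being limits as $|\omega|\to\infty$. Inequalities between matrices are in the sense of Hermitian (semi)definiteness. Channel. Let $A,\ B=[B_1\ B_2],\ C=\begin{bmatrix}C_1\\ C_2\end{bmatrix},\ D=\begin{bmatrix}D_{11}&D_{12}\\ D_{21}&D_{22}\end{bmatrix}$ be complex matrices of sizes $m\times m$, $m\times(n+n_w)$, $(n_y+n_d)\times m$, $(n_y+n_d)\times(n+n_w)$, with $n_y+n_d=n+n_w$, such that $$A+A^\dagger+BB^\dagger=0,\qquad B=-C^\dagger D,\qquad D^\dagger D=DD^\dagger=I,$$ and such that the realization $(A,B,C,D)$ is minimal (controllable and observable). Put $G_{1k}(s)=C_1(sI-A)^{-1}B_k+D_{1k}$, $k=1,2$. Let $\Sigma_u$ ($n\times n$) and $\Sigma_w$ ($n_w\times n_w$) be Hermitian positive definite, and let $$\Phi(s)=\begin{bmatrix}\Psi(s)&-G_{11}(s)(I_n+\Sigma_u^T)\\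 -(I_n+\Sigma_u^T)G_{11}(s)^H&\Sigma_u^T+2I_n\end{bmatrix},\qquad \Psi(s)=G_{11}(s)\Sigma_u^TG_{11}(s)^H+G_{12}(s)\Sigma_w^TG_{12}(s)^H .$$ Equalization problem. An admissible equalizer is a square transfer function $H=\begin{bmatrix}H_{11}&H_{12}\\ H_{21}&H_{22}\end{bmatrix}$ of size $n_f\times n_f$, $n_f=n_y+n_z\ge n$ for some $n_z\ge 0$, with $H_{11}$ of size $n\times n_y$, which belongs to the Hardy space $H_\infty$ of the right half-plane, is analytic in a half-plane $\mathrm{Re}\,s>-\tau$ for some $\tau>0$, and is paraunitary: $H(s)^HH(s)=H(s)H(s)^H=I$. The power spectrum density of the error $e=\hat u-u$ of the filter output $\hat u=H_{11}y+H_{12}z$, where $y=G_{11}u+G_{12}w$ and the uncorrelated inputs $u,w,z$ have spectral densities $I+\Sigma_u^T$, $I+\Sigma_w^T$, $I$, is $$P_e=(H_{11}G_{11}-I)(I+\Sigma_u^T)(H_{11}G_{11}-I)^H+H_{11}G_{12}(I+\Sigma_w^T)(H_{11}G_{12})^H+H_{12}H_{12}^H,$$ which on the imaginary axis equals $$P_e[H_{11}](s):=\begin{bmatrix}H_{11}(s)&I\end{bmatrix}\Phi(s)\begin{bmatrix}H_{11}(s)^H\\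 I\end{bmatrix}.$$ Let $\gamma_\circ$ be the infimum of the $\gamma>0$ for which there is an admissible $H$ (with any $n_z$) such that $P_e(i\omega)<\gamma^2I_n$ for all $\omega\in\mathbf R$. Relaxations. For $\gamma>0$ consider the $n\times n_y$ transfer functions $H_{11}$ that have all their poles in the open left half-plane, are analytic in a half-plane $\mathrm{Re}\,s>-\tau$ for some $\tau>0$, and satisfy $P_e[H_{11}](i\omega)<\gamma^2I_n$ for all $\omega\in\mathbf R$. Let $\mathcal H_{11,\gamma}$ be the set of those with $H_{11}(i\omega)H_{11}(i\omega)^\dagger\le I_n$ for all $\omega\in\mathbf R$; let $\mathcal H^-_{11,\gamma}$ be the set of those that are proper with $H_{11}(i\omega)H_{11}(i\omega)^\dagger<I_n$ for all $\omega\in\bar{\mathbf R}$; and let $\mathcal H^\infty_{11,\gamma}$ be the set of those that belong to $H_\infty$. Let $\gamma_\circ'$, $\gamma_\circ''$, $\gamma_*$ be the infima of the $\gamma>0$ for which $\mathcal H_{11,\gamma}$, $\mathcal H^-_{11,\gamma}$, $\mathcal H^\infty_{11,\gamma}$, respectively, is non-empty. Theorem. Suppose $\gamma>0$ is such that $\mathcal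 H^-_{11,\gamma}\ne\emptyset$, and suppose there is $\theta>0$ such that $$\theta\left(\Phi(i\omega)-\gamma^2\begin{bmatrix}0&0\\0&I_n\end{bmatrix}\right)-\begin{bmatrix}I_{n_y}&0\\0&-I_n\end{bmatrix}>0\qquad\text{for all }\omega\in\bar{\mathbf R}.$$ Then $\mathcal H^-_{11,\gamma}=\mathcal H^\infty_{11,\gamma}$. Consequently $\gamma_\circ=\gamma_*=\gamma_\circ'=\gamma_\circ''$. -/

import Mathlib

open Matrix Filter Topology
open scoped ComplexOrder

noncomputable section

namespace CoherentEqualizer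

/-! ### Rational transfer matrices -/

/-- Rational matrix transfer functions with rows indexed by `p` and columns indexed by `q`. -/
abbrev TransferMatrix (p q : Type) := Matrix p q (RatFunc ℂ)

namespace TransferMatrix

variable {p q : Type}

/-- The value `H(s)` (the conventional value `0` is taken by an entry that has a pole at `s`). -/
def evalAt (H : TransferMatrix p q) (s : ℂ) : Matrix p q ℂ :=
  fun i j => (H i j).eval (RingHom.id ℂ) s

/-- `s` is a pole of some entry of `H` (denominators are in lowest terms). -/
def IsPole (H : TransferMatrix p q) (s : ℂ) : Prop :=
  ∃ i j, (H i j).denom.eval s = 0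

/-- Proper: every entry has a finite value at infinity. -/
def IsProper (H : TransferMatrix p q) : Prop :=
  ∀ i j, (H i j).num.natDegree ≤ (H i j).denom.natDegree

/-- All poles lie in the open left half-plane, and `H` is analytic in a half-plane `Re s > -τ`
for some `τ > 0`. -/
def IsStable (H : TransferMatrix p q) : Prop :=
  (∀ s : ℂ, H.IsPole s → s.re < 0) ∧ ∃ τ : ℝ, 0 < τ ∧ ∀ s : ℂ, -τ < s.re → ¬ H.IsPole s

/-- Membership in the Hardy space `H_∞` of the right half-plane: analytic and bounded in
`Re s > 0`. -/
def IsHardyInfty (H : TransferMatrix p q) : Prop :=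
  (∀ s : ℂ, 0 < s.re → ¬ H.IsPole s) ∧
    ∃ M : ℝ, ∀ s : ℂ, 0 < s.re → ∀ i j, ‖H.evalAt s i j‖ ≤ M

end TransferMatrix

/-- The para-Hermitian conjugate `F(s)^H = F(-s*)†` of a matrix function. -/
def paraConj {p q : Type} (F : ℂ → Matrix p q ℂ) (s : ℂ) : Matrix q p ℂ :=
  (F (-(starRingEnd ℂ s)))ᴴ

/-- `H(s)^H H(s) = H(s) H(s)^H = I` at all `s` where both `H(s)` and `H(s)^H` are defined. -/
def TransferMatrix.IsParaunitary {p q : Type} [Fintype p] [Fintype q] [DecidableEq p]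
    [DecidableEq q] (H : TransferMatrix p q) : Prop :=
  ∀ s : ℂ, ¬ H.IsPole s → ¬ H.IsPole (-(starRingEnd ℂ s)) →
    paraConj H.evalAt s * H.evalAt s = 1 ∧ H.evalAt s * paraConj H.evalAt s = 1

/-- The point `iω` of the imaginary axis. -/
def iAxis (ω : ℝ) : ℂ := Complex.I * (ω : ℂ)

/-- `F(ω) > 0` for all `ω` in the closed real axis `ℝ ∪ {±∞}`, the value at `±∞` being the limit
of `F(ω)` as `|ω| → ∞`, which is required to exist. -/
def PosDefOnClosedAxis {p : Type} (F : ℝ → Matrix p p ℂ) : Prop :=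
  (∀ ω : ℝ, (F ω).PosDef) ∧
    ∃ L : Matrix p p ℂ, Tendsto F (cocompact ℝ) (𝓝 L) ∧ L.PosDef

/-! ### The channel -/

/-- The coefficients of the channel
`ȧ = A a + B₁ u + B₂ w`, `y = C₁ a + D₁₁ u + D₁₂ w`, `d = C₂ a + D₂₁ u + D₂₂ w`
and the intensity matrices `Σ_u`, `Σ_w` of the thermal fields `u`, `w`. -/
structure Channel (m n nw ny nd : ℕ) where
  A : Matrix (Fin m) (Fin m) ℂ
  B₁ : Matrix (Fin m) (Fin n) ℂ
  B₂ : Matrix (Fin m) (Fin nw) ℂ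
  C₁ : Matrix (Fin ny) (Fin m) ℂ
  C₂ : Matrix (Fin nd) (Fin m) ℂ
  D₁₁ : Matrix (Fin ny) (Fin n) ℂ
  D₁₂ : Matrix (Fin ny) (Fin nw) ℂ
  D₂₁ : Matrix (Fin nd) (Fin n) ℂ
  D₂₂ : Matrix (Fin nd) (Fin nw) ℂ
  Su : Matrix (Fin n) (Fin n) ℂ
  Sw : Matrix (Fin nw) (Fin nw) ℂ

namespace Channel

variable {m n nw ny nd : ℕ} (S : Channel m n nw ny nd)

def B : Matrix (Fin m) (Fin n ⊕ Fin nw) ℂ := fromCols S.B₁ S.B₂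

def C : Matrix (Fin ny ⊕ Fin nd) (Fin m) ℂ := fromRows S.C₁ S.C₂

def D : Matrix (Fin ny ⊕ Fin nd) (Fin n ⊕ Fin nw) ℂ := fromBlocks S.D₁₁ S.D₁₂ S.D₂₁ S.D₂₂

/-- Physical realizability of the completely passive channel: `A + A† + B B† = 0`, `B = -C† D`,
`D† D = D D† = I` (in particular `n_y + n_d = n + n_w`). -/
structure IsPhysicallyRealizable : Prop where
  lyapunov : S.A + S.Aᴴ + S.B * S.Bᴴ = 0
  coupling : S.B = -(S.Cᴴ * S.D)
  unitary_left : S.Dᴴ * S.D = 1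
  unitary_right : S.D * S.Dᴴ = 1

/-- Minimality of the realization `(A, B, C, D)`: the pair `(A, B)` is controllable (the columns
of `B, AB, …, A^{m-1}B` span the state space) and the pair `(C, A)` is observable. -/
structure IsMinimal : Prop where
  controllable : Submodule.span ℂ
    {x : Fin m → ℂ | ∃ k < m, ∃ j : Fin n ⊕ Fin nw, x = (S.A ^ k * S.B).col j} = ⊤
  observable : ∀ x : Fin m → ℂ, (∀ k < m, (S.C * S.A ^ k) *ᵥ x = 0) → x = 0

/-- `G₁₁(s) = C₁ (sI - A)⁻¹ B₁ + D₁₁`, the transfer function from `u` to `y`. -/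
def G₁₁ (s : ℂ) : Matrix (Fin ny) (Fin n) ℂ := S.C₁ * (s • 1 - S.A)⁻¹ * S.B₁ + S.D₁₁

/-- `G₁₂(s) = C₁ (sI - A)⁻¹ B₂ + D₁₂`, the transfer function from `w` to `y`. -/
def G₁₂ (s : ℂ) : Matrix (Fin ny) (Fin nw) ℂ := S.C₁ * (s • 1 - S.A)⁻¹ * S.B₂ + S.D₁₂

def Psi (s : ℂ) : Matrix (Fin ny) (Fin ny) ℂ :=
  S.G₁₁ s * S.Suᵀ * paraConj S.G₁₁ s + S.G₁₂ s * S.Swᵀ * paraConj S.G₁₂ s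

def Phi (s : ℂ) : Matrix (Fin ny ⊕ Fin n) (Fin ny ⊕ Fin n) ℂ :=
  fromBlocks (S.Psi s) (-(S.G₁₁ s * (1 + S.Suᵀ)))
    (-((1 + S.Suᵀ) * paraConj S.G₁₁ s)) (S.Suᵀ + 2 • (1 : Matrix (Fin n) (Fin n) ℂ))

/-! ### Power spectrum density of the equalization error -/

/-- `[H₁₁(s)  I] Φ(s) [H₁₁(s)^H ; I]`: the power spectrum density of the error as a function of
the block `H₁₁` alone. It is this expression that enters the relaxed problems, in which `H₁₁` need
not be a block of a paraunitary `H`. -/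
def Pe (H₁₁ : TransferMatrix (Fin n) (Fin ny)) (s : ℂ) : Matrix (Fin n) (Fin n) ℂ :=
  fromCols (H₁₁.evalAt s) (1 : Matrix (Fin n) (Fin n) ℂ) * S.Phi s *
    fromRows (paraConj H₁₁.evalAt s) (1 : Matrix (Fin n) (Fin n) ℂ)

/-- The power spectrum density of `e = û - u`, where `û = H₁₁ y + H₁₂ z` is the output of the
filter `H` driven by `y = G₁₁ u + G₁₂ w` and by the filter environment `z`. Thus
`e = (H₁₁ G₁₁ - I) u + H₁₁ G₁₂ w + H₁₂ z` where `u`, `w`, `z` are mutually uncorrelated with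
`⟨u(t) u(0)†⟩ = (I + Σ_uᵀ) δ(t)`, `⟨w(t) w(0)†⟩ = (I + Σ_wᵀ) δ(t)` (thermal fields) and
`⟨z(t) z(0)†⟩ = I δ(t)` (vacuum). -/
def errorPSD {nz k : ℕ} (H : TransferMatrix (Fin n ⊕ Fin k) (Fin ny ⊕ Fin nz)) (s : ℂ) :
    Matrix (Fin n) (Fin n) ℂ :=
  let Tu : ℂ → Matrix (Fin n) (Fin n) ℂ := fun s => (H.evalAt s).toBlocks₁₁ * S.G₁₁ s - 1
  let Tw : ℂ → Matrix (Fin n) (Fin nw) ℂ := fun s => (H.evalAt s).toBlocks₁₁ * S.G₁₂ s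
  let Tz : ℂ → Matrix (Fin n) (Fin nz) ℂ := fun s => (H.evalAt s).toBlocks₁₂
  Tu s * (1 + S.Suᵀ) * paraConj Tu s + Tw s * (1 + S.Swᵀ) * paraConj Tw s + Tz s * paraConj Tz s

end Channel

/-! ### The equalization problem and its relaxations -/

/-- `H` represents an admissible completely passive physically realizable equalizer: a square
(`n + k = n_y + n_z`) stable rational element of `H_∞` which is paraunitary. -/
structure IsAdmissible {n ny nz k : ℕ} (H : TransferMatrix (Fin n ⊕ Fin k) (Fin ny ⊕ Fin nz)) :
    Prop where
  square : n + k = ny + nz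
  hardy : H.IsHardyInfty
  stable : H.IsStable
  paraunitary : H.IsParaunitary

namespace Channel

variable {m n nw ny nd : ℕ} (S : Channel m n nw ny nd)

/-- The optimal equalization performance `γ_∘`. The dimension `n_z` of the filter environment is
not fixed in advance. -/
def gammaOpt : ℝ :=
  sInf {γ : ℝ | 0 < γ ∧ ∃ (nz k : ℕ) (H : TransferMatrix (Fin n ⊕ Fin k) (Fin ny ⊕ Fin nz)),
    IsAdmissible H ∧
      ∀ ω : ℝ, (γ ^ 2 • (1 : Matrix (Fin n) (Fin n) ℂ) - S.errorPSD H (iAxis ω)).PosDef}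

/-- `P_e(iω) < γ² I` for all real `ω`. -/
def SatisfiesBound (γ : ℝ) (H₁₁ : TransferMatrix (Fin n) (Fin ny)) : Prop :=
  ∀ ω : ℝ, (γ ^ 2 • (1 : Matrix (Fin n) (Fin n) ℂ) - S.Pe H₁₁ (iAxis ω)).PosDef

/-- The set `𝓗_{11,γ}`: stable, `P_e(iω) < γ² I` and `H₁₁(iω) H₁₁(iω)† ≤ I` on the real axis. -/
def setH (γ : ℝ) : Set (TransferMatrix (Fin n) (Fin ny)) :=
  {H₁₁ | H₁₁.IsStable ∧ S.SatisfiesBound γ H₁₁ ∧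
    ∀ ω : ℝ, (1 - H₁₁.evalAt (iAxis ω) * (H₁₁.evalAt (iAxis ω))ᴴ).PosSemidef}

/-- The set `𝓗⁻_{11,γ}`: proper, stable, `P_e(iω) < γ² I` on the real axis and
`H₁₁(iω) H₁₁(iω)† < I` on the closed real axis. -/
def setHMinus (γ : ℝ) : Set (TransferMatrix (Fin n) (Fin ny)) :=
  {H₁₁ | H₁₁.IsProper ∧ H₁₁.IsStable ∧ S.SatisfiesBound γ H₁₁ ∧
    PosDefOnClosedAxis fun ω : ℝ => 1 - H₁₁.evalAt (iAxis ω) * (H₁₁.evalAt (iAxis ω))ᴴ}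

/-- The set `𝓗^∞_{11,γ}`: elements of `H_∞` which are stable and satisfy `P_e(iω) < γ² I`,
without a constraint on the magnitude of `H₁₁(iω)`. -/
def setHInfty (γ : ℝ) : Set (TransferMatrix (Fin n) (Fin ny)) :=
  {H₁₁ | H₁₁.IsHardyInfty ∧ H₁₁.IsStable ∧ S.SatisfiesBound γ H₁₁}

/-- `γ_∘'`. -/
def gammaPrime : ℝ := sInf {γ : ℝ | 0 < γ ∧ (S.setH γ).Nonempty}

/-- `γ_∘''`. -/
def gammaDoublePrime : ℝ := sInf {γ : ℝ | 0 < γ ∧ (S.setHMinus γ).Nonempty}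

/-- `γ_*`. -/
def gammaStar : ℝ := sInf {γ : ℝ | 0 < γ ∧ (S.setHInfty γ).Nonempty}

end Channel

end CoherentEqualizer

end

/-!
Paraconjugation `F ↦ F^H` turns `ℂ(s)` into a field with involution, and over this field the
completion of a strict contraction to an admissible equalizer is linear algebra.

* A scalar rational function that is nonnegative on the imaginary axis is of the form `g g^H`,
  because its zeros and poles are symmetric about the axis (`exists_eq_mul_star`). Hence a matrix that is
  positive definite on the axis defines a form over `ℂ(s)` whose values at non-zero vectors have
  the form `g g^H` with `g ≠ 0`, and Gram-Schmidt orthonormalization applies to it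
  (`NormDefinite.exists_orthonormal_extension`).
* For `F(iω) F(iω)† < I` this gives `W` with `F F^H + W W^H = I`, and then rows that complete
  `[F W]` to a unitary matrix over `ℂ(s)`. Poles in the open right half-plane are removed from
  `W` and from the added rows by scalar all-pass factors, which do not affect unitarity
  (`exists_allPass_regularAt`). A matrix that is unitary on the axis is bounded there, so it has no
  poles on the axis and is proper; thus the completion is admissible (`exists_isAdmissible`). No
  state-space realization or Riccati equation is involved.
* The channel is all-pass on the axis, as `A` has no imaginary eigenvalues by controllability.
  Therefore the error spectrum of an admissible equalizer `H` is `P_e[H₁₁]`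
  (`Channel.errorPSD_eq_Pe`).
* The identity `I - F F† = θ (γ² I - P_e[F]) + [F I] (θ (Φ - γ² diag(0, I)) - diag(I, -I)) [F I]†`
  shows that the condition on `θ` makes the bound on the error spectrum imply `F F† < I`, up to
  infinity (`Channel.setHMinus_eq_setHInfty`).

The condition on `θ` at `γ` persists at smaller values, and the problems are all solvable at larger
ones, so the four infima are taken over the same set.
-/

noncomputable section

namespace CoherentEqualizer

open Polynomial

/-! ### Evaluation of rational functions -/

/-- `s` is not a pole of the rational function `f`. -/
def RegularAt (f : RatFunc ℂ) (s : ℂ) : Prop := f.denom.eval s ≠ 0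

lemma RegularAt.of_div {p q : ℂ[X]} {s : ℂ} (hq : q.eval s ≠ 0) :
    RegularAt (algebraMap ℂ[X] (RatFunc ℂ) p / algebraMap ℂ[X] (RatFunc ℂ) q) s := by
  obtain ⟨r, hr⟩ := RatFunc.denom_div_dvd p q
  intro h
  apply hq
  rw [hr, eval_mul, h, zero_mul]

lemma eval_algebraMap_div {p q : ℂ[X]} {s : ℂ} (hq : q.eval s ≠ 0) :
    (algebraMap ℂ[X] (RatFunc ℂ) p / algebraMap ℂ[X] (RatFunc ℂ) q).eval (RingHom.id ℂ) s =
      p.eval s / q.eval s := by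
  set f := algebraMap ℂ[X] (RatFunc ℂ) p / algebraMap ℂ[X] (RatFunc ℂ) q with hf
  have hd : f.denom.eval s ≠ 0 := RegularAt.of_div hq
  have hq0 : q ≠ 0 := by rintro rfl; simp at hq
  have h := RatFunc.num_div_denom f
  have hqK : algebraMap ℂ[X] (RatFunc ℂ) q ≠ 0 := RatFunc.algebraMap_ne_zero hq0
  have hdK : algebraMap ℂ[X] (RatFunc ℂ) f.denom ≠ 0 :=
    RatFunc.algebraMap_ne_zero (RatFunc.denom_ne_zero f)
  rw [hf, ← hf, div_eq_div_iff hdK hqK, ← map_mul, ← map_mul] at h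
  have h2 := congrArg (Polynomial.eval s) (RatFunc.algebraMap_injective ℂ h)
  rw [eval_mul, eval_mul] at h2
  change f.num.eval₂ (RingHom.id ℂ) s / f.denom.eval₂ (RingHom.id ℂ) s = _
  rw [← Polynomial.eval, ← Polynomial.eval, div_eq_div_iff hd hq, h2]

lemma eval_eq_num_div_denom (f : RatFunc ℂ) (s : ℂ) :
    f.eval (RingHom.id ℂ) s = f.num.eval s / f.denom.eval s := rfl

namespace RegularAt

variable {f g : RatFunc ℂ} {s : ℂ}

lemma algebraMap (p : ℂ[X]) (s : ℂ) : RegularAt (algebraMap ℂ[X] (RatFunc ℂ) p) s := by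
  simp [RegularAt]

lemma zero (s : ℂ) : RegularAt 0 s := by simp [RegularAt]

lemma one (s : ℂ) : RegularAt 1 s := by simp [RegularAt]

lemma add (hf : RegularAt f s) (hg : RegularAt g s) : RegularAt (f + g) s := by
  obtain ⟨r, hr⟩ := RatFunc.denom_add_dvd f g
  intro h
  have := congrArg (Polynomial.eval s) hr
  rw [eval_mul, eval_mul, h, zero_mul] at this
  exact mul_ne_zero hf hg this

lemma mul (hf : RegularAt f s) (hg : RegularAt g s) : RegularAt (f * g) s := by
  obtain ⟨r, hr⟩ := RatFunc.denom_mul_dvd f g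
  intro h
  have := congrArg (Polynomial.eval s) hr
  rw [eval_mul, eval_mul, h, zero_mul] at this
  exact mul_ne_zero hf hg this

lemma sum {ι : Type*} {t : Finset ι} {F : ι → RatFunc ℂ} (h : ∀ i ∈ t, RegularAt (F i) s) :
    RegularAt (∑ i ∈ t, F i) s :=
  Finset.sum_induction F (RegularAt · s) (fun _ _ => add) (zero s) h

lemma eval_add (hf : RegularAt f s) (hg : RegularAt g s) :
    (f + g).eval (RingHom.id ℂ) s = f.eval (RingHom.id ℂ) s + g.eval (RingHom.id ℂ) s :=
  RatFunc.eval_add _ _ hf hg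

lemma eval_mul (hf : RegularAt f s) (hg : RegularAt g s) :
    (f * g).eval (RingHom.id ℂ) s = f.eval (RingHom.id ℂ) s * g.eval (RingHom.id ℂ) s :=
  RatFunc.eval_mul _ _ hf hg

lemma eval_sum {ι : Type*} {t : Finset ι} {F : ι → RatFunc ℂ} (h : ∀ i ∈ t, RegularAt (F i) s) :
    (∑ i ∈ t, F i).eval (RingHom.id ℂ) s = ∑ i ∈ t, (F i).eval (RingHom.id ℂ) s := by
  classical
  induction t using Finset.induction_on with
  | empty => simp
  | insert a t ha ih =>
    rw [Finset.sum_insert ha, Finset.sum_insert ha,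
      eval_add (h a (by simp)) (sum fun i hi => h i (by simp [hi])),
      ih fun i hi => h i (by simp [hi])]

end RegularAt

lemma finite_setOf_not_regularAt (f : RatFunc ℂ) : {s | ¬ RegularAt f s}.Finite := by
  refine (Polynomial.finite_setOfPred_isRoot (RatFunc.denom_ne_zero f)).subset ?_
  intro s hs
  simpa [RegularAt] using hs

lemma iAxis_injective : Function.Injective iAxis := by
  intro a b h
  simpa [iAxis] using h

lemma neg_conj_iAxis (ω : ℝ) : -(starRingEnd ℂ (iAxis ω)) = iAxis ω := by
  simp [iAxis]

lemma iAxis_re (ω : ℝ) : (iAxis ω).re = 0 := by simp [iAxis]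

lemma eq_iAxis_of_re_eq_zero {s : ℂ} (hs : s.re = 0) : s = iAxis s.im := by
  apply Complex.ext <;> simp [iAxis, hs]

lemma eventually_iAxis_of_finite {t : Set ℂ} (ht : t.Finite) :
    ∀ᶠ ω : ℝ in cofinite, iAxis ω ∉ t :=
  iAxis_injective.tendsto_cofinite.eventually ht.compl_mem_cofinite

lemma eventually_regularAt_iAxis (f : RatFunc ℂ) :
    ∀ᶠ ω : ℝ in cofinite, RegularAt f (iAxis ω) := by
  filter_upwards [eventually_iAxis_of_finite (finite_setOf_not_regularAt f)] with ω h
  simpa using h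

/-- A rational function that vanishes at all but finitely many points of the axis is zero. -/
lemma eq_zero_of_eventually_eval_eq_zero {f : RatFunc ℂ}
    (h : ∀ᶠ ω : ℝ in cofinite, f.eval (RingHom.id ℂ) (iAxis ω) = 0) : f = 0 := by
  rw [← RatFunc.num_eq_zero_iff]
  apply Polynomial.eq_zero_of_infinite_isRoot
  have h2 : ∀ᶠ ω : ℝ in cofinite, f.num.eval (iAxis ω) = 0 := by
    filter_upwards [h, eventually_regularAt_iAxis f] with ω h1 h2
    rw [eval_eq_num_div_denom] at h1
    exact (div_eq_zero_iff.mp h1).resolve_right h2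
  have hinf : {ω : ℝ | f.num.eval (iAxis ω) = 0}.Infinite := by
    intro hfin
    have := hfin.union (show {ω : ℝ | ¬ f.num.eval (iAxis ω) = 0}.Finite from h2)
    refine Set.infinite_univ (this.subset ?_)
    intro x _
    by_cases hx : f.num.eval (iAxis x) = 0
    · exact Or.inl hx
    · exact Or.inr hx
  refine (hinf.image iAxis_injective.injOn).mono ?_
  rintro _ ⟨ω, hω, rfl⟩
  exact hω

/-! ### Paraconjugation as an involution of the field of rational functions -/

/-- The paraconjugate polynomial, `s ↦ conj (p (-conj s))`. -/
def polyConj : ℂ[X] →+* ℂ[X] :=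
  (Polynomial.compRingHom (-X)).comp (Polynomial.mapRingHom (starRingEnd ℂ))

lemma eval_polyConj (p : ℂ[X]) (s : ℂ) :
    (polyConj p).eval s = starRingEnd ℂ (p.eval (-(starRingEnd ℂ s))) := by
  have : (-s) = starRingEnd ℂ (-(starRingEnd ℂ s)) := by simp
  simp only [polyConj, RingHom.comp_apply, coe_compRingHom_apply, coe_mapRingHom, eval_comp,
    eval_neg, eval_X]
  rw [this, Polynomial.eval_map, Polynomial.eval₂_hom]

lemma polyConj_polyConj (p : ℂ[X]) : polyConj (polyConj p) = p := by
  apply Polynomial.funext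
  intro s
  simp [eval_polyConj]

lemma polyConj_injective : Function.Injective polyConj :=
  Function.LeftInverse.injective polyConj_polyConj

/-- Paraconjugation `f ↦ f^H` of rational functions. -/
def ratConj : RatFunc ℂ →+* RatFunc ℂ :=
  RatFunc.mapRingHom polyConj
    (nonZeroDivisors_le_comap_nonZeroDivisors_of_injective _ polyConj_injective)

lemma ratConj_div (p q : ℂ[X]) :
    ratConj (algebraMap ℂ[X] (RatFunc ℂ) p / algebraMap ℂ[X] (RatFunc ℂ) q) =
      algebraMap ℂ[X] (RatFunc ℂ) (polyConj p) / algebraMap ℂ[X] (RatFunc ℂ) (polyConj q) := by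
  rw [ratConj, RatFunc.coe_mapRingHom_eq_coe_map, RatFunc.map_apply_div]

/-- Paraconjugation makes `ℂ(s)` a field with involution; the conjugate transpose of a transfer
matrix over it is `s ↦ H(s)^H`. -/
instance : StarRing (RatFunc ℂ) where
  star := ratConj
  star_involutive f := by
    conv_lhs => rw [← RatFunc.num_div_denom f, ratConj_div, ratConj_div, polyConj_polyConj,
      polyConj_polyConj, RatFunc.num_div_denom f]
  star_mul f g := by rw [map_mul, mul_comm]
  star_add f g := map_add _ f g

lemma star_algebraMap_div (p q : ℂ[X]) :
    star (algebraMap ℂ[X] (RatFunc ℂ) p / algebraMap ℂ[X] (RatFunc ℂ) q) =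
      algebraMap ℂ[X] (RatFunc ℂ) (polyConj p) / algebraMap ℂ[X] (RatFunc ℂ) (polyConj q) :=
  ratConj_div p q

lemma star_eq_div (f : RatFunc ℂ) :
    star f = algebraMap ℂ[X] (RatFunc ℂ) (polyConj f.num) /
      algebraMap ℂ[X] (RatFunc ℂ) (polyConj f.denom) := by
  conv_lhs => rw [← RatFunc.num_div_denom f]
  exact star_algebraMap_div _ _

lemma RegularAt.star {f : RatFunc ℂ} {s : ℂ} (h : RegularAt f (-(starRingEnd ℂ s))) :
    RegularAt (star f) s := by
  rw [star_eq_div]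
  apply RegularAt.of_div
  rw [eval_polyConj]
  simpa [RegularAt] using h

lemma RegularAt.eval_star {f : RatFunc ℂ} {s : ℂ} (h : RegularAt f (-(starRingEnd ℂ s))) :
    (Star.star f).eval (RingHom.id ℂ) s =
      starRingEnd ℂ (f.eval (RingHom.id ℂ) (-(starRingEnd ℂ s))) := by
  rw [star_eq_div, eval_algebraMap_div, eval_polyConj, eval_polyConj, eval_eq_num_div_denom,
    map_div₀]
  rw [eval_polyConj]
  simpa [RegularAt] using h

/-! ### Evaluation of transfer matrices -/

namespace TransferMatrix

variable {p q r : Type} {s : ℂ}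

lemma not_isPole_iff {H : TransferMatrix p q} :
    ¬ H.IsPole s ↔ ∀ i j, RegularAt (H i j) s := by
  simp [IsPole, RegularAt]

lemma evalAt_mul [Fintype q] {M : TransferMatrix p q} {N : TransferMatrix q r}
    (hM : ¬ M.IsPole s) (hN : ¬ N.IsPole s) :
    evalAt (M * N) s = evalAt M s * evalAt N s := by
  rw [not_isPole_iff] at hM hN
  ext i j
  simp only [evalAt, Matrix.mul_apply]
  rw [RegularAt.eval_sum fun k _ => (hM i k).mul (hN k j)]
  exact Finset.sum_congr rfl fun k _ => (hM i k).eval_mul (hN k j)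

lemma not_isPole_mul [Fintype q] {M : TransferMatrix p q} {N : TransferMatrix q r}
    (hM : ¬ M.IsPole s) (hN : ¬ N.IsPole s) : ¬ IsPole (M * N) s := by
  rw [not_isPole_iff] at *
  exact fun i j => RegularAt.sum fun k _ => (hM i k).mul (hN k j)

lemma evalAt_one [DecidableEq p] : evalAt (1 : TransferMatrix p p) s = 1 := by
  ext i j
  by_cases h : i = j <;> simp [evalAt, Matrix.one_apply, h]

lemma not_isPole_one [DecidableEq p] : ¬ IsPole (1 : TransferMatrix p p) s := by
  rw [not_isPole_iff]
  intro i j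
  by_cases h : i = j <;> simp [Matrix.one_apply, h, RegularAt.zero, RegularAt.one]

lemma not_isPole_conjTranspose {M : TransferMatrix p q} (h : ¬ M.IsPole (-(starRingEnd ℂ s))) :
    ¬ IsPole Mᴴ s := by
  rw [not_isPole_iff] at *
  exact fun i j => (h j i).star

lemma evalAt_conjTranspose {M : TransferMatrix p q} (h : ¬ M.IsPole (-(starRingEnd ℂ s))) :
    evalAt Mᴴ s = paraConj M.evalAt s := by
  rw [not_isPole_iff] at h
  ext i j
  exact (h j i).eval_star

lemma paraConj_iAxis (F : ℂ → Matrix p q ℂ) (ω : ℝ) :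
    paraConj F (iAxis ω) = (F (iAxis ω))ᴴ := by
  rw [paraConj, neg_conj_iAxis]

lemma finite_setOf_isPole [Finite p] [Finite q] (H : TransferMatrix p q) :
    {s | H.IsPole s}.Finite := by
  have : {s | H.IsPole s} = ⋃ i, ⋃ j, {s | ¬ RegularAt (H i j) s} := by
    ext s
    simp [IsPole, RegularAt]
  rw [this]
  exact Set.finite_iUnion fun i => Set.finite_iUnion fun j => finite_setOf_not_regularAt _

lemma eventually_not_isPole_iAxis [Finite p] [Finite q] (H : TransferMatrix p q) :
    ∀ᶠ ω : ℝ in cofinite, ¬ H.IsPole (iAxis ω) :=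
  eventually_iAxis_of_finite (finite_setOf_isPole H)

lemma evalAt_mul_conjTranspose_iAxis [Fintype q] {M : TransferMatrix p q} {N : TransferMatrix r q}
    {ω : ℝ} (hM : ¬ M.IsPole (iAxis ω)) (hN : ¬ N.IsPole (iAxis ω)) :
    evalAt (M * Nᴴ) (iAxis ω) = evalAt M (iAxis ω) * (evalAt N (iAxis ω))ᴴ := by
  have hN' : ¬ N.IsPole (-(starRingEnd ℂ (iAxis ω))) := by rwa [neg_conj_iAxis]
  rw [evalAt_mul hM (not_isPole_conjTranspose hN'), evalAt_conjTranspose hN', paraConj_iAxis]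

lemma eq_zero_of_eventually_evalAt_eq_zero {M : TransferMatrix p q}
    (h : ∀ᶠ ω : ℝ in cofinite, M.evalAt (iAxis ω) = 0) : M = 0 := by
  ext i j
  exact eq_zero_of_eventually_eval_eq_zero (h.mono fun ω hω => congrFun (congrFun hω i) j)

end TransferMatrix

/-! ### Spectral factorization of scalar functions -/

lemma forall_mem_of_eventually_cofinite {C : Set ℝ} (hC : IsClosed C)
    (h : ∀ᶠ ω : ℝ in cofinite, ω ∈ C) (ω : ℝ) : ω ∈ C := by
  have hd : Dense ((Set.univ : Set ℝ) \ {ω | ¬ ω ∈ C}) := dense_univ.sdiff_finite h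
  have : Dense C := hd.mono fun x hx => by simpa using hx.2
  rw [← hC.closure_eq, this.closure_eq]
  trivial

lemma continuous_iAxis : Continuous iAxis := by
  unfold iAxis
  fun_prop

lemma continuous_eval_iAxis (p : ℂ[X]) : Continuous fun ω : ℝ => p.eval (iAxis ω) :=
  p.continuous.comp continuous_iAxis

lemma eval_nonneg_of_eventually {p : ℂ[X]} (h : ∀ᶠ ω : ℝ in cofinite, 0 ≤ p.eval (iAxis ω))
    (ω : ℝ) : 0 ≤ p.eval (iAxis ω) :=
  forall_mem_of_eventually_cofinite (C := {ω : ℝ | 0 ≤ p.eval (iAxis ω)})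
    (isClosed_le continuous_const (continuous_eval_iAxis p)) h ω

lemma nonneg_of_ofReal_mul_nonneg {x : ℝ} (hx : 0 < x) {z : ℂ} (h : 0 ≤ (x : ℂ) * z) : 0 ≤ z := by
  rw [Complex.nonneg_iff] at h ⊢
  rw [Complex.re_ofReal_mul, Complex.im_ofReal_mul] at h
  refine ⟨(mul_nonneg_iff_of_pos_left hx).mp h.1, ?_⟩
  simpa [hx.ne', eq_comm] using h.2

lemma polyConj_X_sub_C (a : ℂ) :
    polyConj (X - C a) = -(X - C (-(starRingEnd ℂ a))) := by
  simp [polyConj]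
  ring

lemma eval_polyConj_iAxis (p : ℂ[X]) (ω : ℝ) :
    (polyConj p).eval (iAxis ω) = starRingEnd ℂ (p.eval (iAxis ω)) := by
  rw [eval_polyConj, neg_conj_iAxis]

lemma polyConj_eq_self_of_nonneg {r : ℂ[X]} (h : ∀ ω : ℝ, 0 ≤ r.eval (iAxis ω)) :
    polyConj r = r := by
  rw [← sub_eq_zero]
  apply Polynomial.eq_zero_of_infinite_isRoot
  refine (Set.infinite_range_of_injective iAxis_injective).mono ?_
  rintro _ ⟨ω, rfl⟩
  have : starRingEnd ℂ (r.eval (iAxis ω)) = r.eval (iAxis ω) :=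
    Complex.conj_eq_iff_im.mpr (Complex.nonneg_iff.mp (h ω)).2.symm
  simp [eval_polyConj_iAxis, this]

/-- The zeros of a polynomial that is nonnegative on the axis are symmetric with respect to the
axis, those on the axis having even multiplicity. -/
lemma mul_polyConj_dvd_of_isRoot {r : ℂ[X]} (h : ∀ ω : ℝ, 0 ≤ r.eval (iAxis ω)) {a : ℂ}
    (ha : r.IsRoot a) : (X - C a) * polyConj (X - C a) ∣ r := by
  obtain ⟨t, ht⟩ := dvd_iff_isRoot.mpr ha
  rw [ht]
  refine mul_dvd_mul_left _ ?_
  rw [polyConj_X_sub_C, neg_dvd, dvd_iff_isRoot, IsRoot]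
  by_cases hre : a.re = 0
  · have haω := eq_iAxis_of_re_eq_zero hre
    set ω₀ := a.im
    rw [haω, neg_conj_iAxis]
    have hcont : Continuous fun ω : ℝ => Complex.I * t.eval (iAxis ω) :=
      continuous_const.mul (continuous_eval_iAxis t)
    have key : ∀ ω : ℝ, 0 ≤ ((ω - ω₀ : ℝ) : ℂ) * (Complex.I * t.eval (iAxis ω)) := by
      intro ω
      have := h ω
      rw [ht, haω] at this
      simp only [eval_mul, eval_sub, eval_X, eval_C, iAxis] at this
      simp only [iAxis]
      convert this using 1
      push_cast
      ring
    have h1 : 0 ≤ Complex.I * t.eval (iAxis ω₀) := by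
      refine ge_of_tendsto (hcont.continuousWithinAt (s := Set.Ioi ω₀)) ?_
      filter_upwards [self_mem_nhdsWithin] with ω hω
      exact nonneg_of_ofReal_mul_nonneg (sub_pos.mpr hω) (key ω)
    have h2 : Complex.I * t.eval (iAxis ω₀) ≤ 0 := by
      refine le_of_tendsto (hcont.continuousWithinAt (s := Set.Iio ω₀)) ?_
      filter_upwards [self_mem_nhdsWithin] with ω hω
      have h3 := key ω
      rw [← neg_sub, Complex.ofReal_neg, neg_mul, ← mul_neg] at h3
      exact neg_nonneg.mp (nonneg_of_ofReal_mul_nonneg (sub_pos.mpr hω) h3)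
    exact (mul_eq_zero.mp (le_antisymm h2 h1)).resolve_left Complex.I_ne_zero
  · have h1 : r.eval (-(starRingEnd ℂ a)) = 0 := by
      rw [← polyConj_eq_self_of_nonneg h, eval_polyConj]
      simpa using ha
    rw [ht, eval_mul] at h1
    refine (mul_eq_zero.mp h1).resolve_left ?_
    intro h2
    apply hre
    have := congrArg Complex.re h2
    simp at this
    linarith

lemma exists_eq_mul_polyConj (r : ℂ[X]) (h : ∀ ω : ℝ, 0 ≤ r.eval (iAxis ω)) :
    ∃ g : ℂ[X], r = g * polyConj g := by
  induction hn : r.natDegree using Nat.strong_induction_on generalizing r with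
  | _ n ih =>
    by_cases hdeg : r.natDegree = 0
    · obtain ⟨c, rfl⟩ := natDegree_eq_zero.mp hdeg
      have hc : 0 ≤ c := by simpa using h 0
      obtain ⟨x, hx, rfl⟩ : ∃ x : ℝ, 0 ≤ x ∧ c = (x : ℂ) :=
        ⟨c.re, (Complex.nonneg_iff.mp hc).1,
          Complex.ext rfl (by simpa using (Complex.nonneg_iff.mp hc).2.symm)⟩
      refine ⟨C ((√x : ℝ) : ℂ), ?_⟩
      rw [show polyConj (C ((√x : ℝ) : ℂ)) = C ((√x : ℝ) : ℂ) by simp [polyConj], ← C_mul,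
        ← Complex.ofReal_mul, Real.mul_self_sqrt hx]
    · obtain ⟨a, ha⟩ := IsAlgClosed.exists_root r
        (by rw [Polynomial.degree_eq_natDegree (by rintro rfl; simp at hdeg)]
            exact_mod_cast hdeg)
      obtain ⟨t, ht⟩ := mul_polyConj_dvd_of_isRoot h ha
      have hr0 : r ≠ 0 := by rintro rfl; simp at hdeg
      have hm0 : (X - C a) * polyConj (X - C a) ≠ 0 := by 
        intro h0
        rw [h0, zero_mul] at ht
        exact hr0 ht
      have ht0 : t ≠ 0 := by rintro rfl; simp at ht; exact hr0 ht
      have hmdeg : ((X - C a) * polyConj (X - C a)).natDegree = 2 := by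
        rw [natDegree_mul (left_ne_zero_of_mul hm0) (right_ne_zero_of_mul hm0),
          polyConj_X_sub_C, natDegree_neg, natDegree_X_sub_C, natDegree_X_sub_C]
      have hdt : t.natDegree < n := by
        rw [← hn, ht, natDegree_mul hm0 ht0, hmdeg]
        omega
      have htpos : ∀ ω : ℝ, 0 ≤ t.eval (iAxis ω) := by
        apply eval_nonneg_of_eventually
        filter_upwards [eventually_iAxis_of_finite (Set.finite_singleton a)] with ω hω
        have h1 := h ω
        rw [ht, eval_mul, eval_mul, eval_polyConj_iAxis, Complex.mul_conj] at h1
        refine nonneg_of_ofReal_mul_nonneg ?_ h1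
        rw [Complex.normSq_pos]
        simpa [sub_eq_zero] using hω
      obtain ⟨g, hg⟩ := ih _ hdt t htpos rfl
      refine ⟨(X - C a) * g, ?_⟩
      rw [ht, map_mul]
      conv_lhs => rw [hg]
      ring

/-- Scalar spectral factorization: a rational function that is nonnegative on the axis is of the
form `g g^H`. -/
theorem exists_eq_mul_star {f : RatFunc ℂ}
    (h : ∀ᶠ ω : ℝ in cofinite, 0 ≤ f.eval (RingHom.id ℂ) (iAxis ω)) :
    ∃ g : RatFunc ℂ, f = g * star g := by
  -- `f = p / q = p q^H / (q q^H)`, where `p q^H` is nonnegative on the axis.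
  have hpos : ∀ ω : ℝ, 0 ≤ (f.num * polyConj f.denom).eval (iAxis ω) := by
    apply eval_nonneg_of_eventually
    filter_upwards [h, eventually_regularAt_iAxis f] with ω h1 h2
    have h2' : f.denom.eval (iAxis ω) ≠ 0 := h2
    have : (f.num * polyConj f.denom).eval (iAxis ω) =
        (Complex.normSq (f.denom.eval (iAxis ω)) : ℂ) * f.eval (RingHom.id ℂ) (iAxis ω) := by
      rw [eval_mul, eval_polyConj_iAxis, ← Complex.mul_conj, eval_eq_num_div_denom]
      field_simp
    rw [this]
    refine mul_nonneg ?_ h1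
    rw [Complex.zero_le_real]
    exact Complex.normSq_nonneg _
  obtain ⟨g, hg⟩ := exists_eq_mul_polyConj _ hpos
  refine ⟨algebraMap ℂ[X] (RatFunc ℂ) g / algebraMap ℂ[X] (RatFunc ℂ) f.denom, ?_⟩
  have hd : algebraMap ℂ[X] (RatFunc ℂ) f.denom ≠ 0 :=
    RatFunc.algebraMap_ne_zero (RatFunc.denom_ne_zero f)
  have hd' : algebraMap ℂ[X] (RatFunc ℂ) (polyConj f.denom) ≠ 0 := by
    refine RatFunc.algebraMap_ne_zero ?_
    rw [Ne, map_eq_zero_iff _ polyConj_injective]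
    exact RatFunc.denom_ne_zero f
  rw [star_algebraMap_div, div_mul_div_comm, ← map_mul, ← hg, map_mul,
    mul_div_mul_right _ _ hd', RatFunc.num_div_denom]

/-! ### Orthonormalization over a field with involution -/

section Orthonormal

variable {K : Type*} [Field K] [StarRing K] {ι N : Type*} [Fintype ι] [Fintype N]

/-- The form `x ↦ x P x†` takes a value `g g†` with `g ≠ 0` at every non-zero row `x`. This plays
the role of positive definiteness over a field `K` with involution. -/
def NormDefinite (P : Matrix N N K) : Prop :=
  ∀ x : Matrix Unit N K, x ≠ 0 → ∃ g : K, g ≠ 0 ∧ x * P * xᴴ = (g * star g) • 1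

lemma NormDefinite.exists_orthonormal_row {P : Matrix N N K} (hP : NormDefinite P)
    (R : Matrix ι N K) (hcard : Fintype.card ι < Fintype.card N) :
    ∃ x : Matrix Unit N K, x * P * xᴴ = 1 ∧ x * P * Rᴴ = 0 := by
  have hker : LinearMap.ker (P * Rᴴ).vecMulLinear ≠ ⊥ :=
    LinearMap.ker_ne_bot_of_finrank_lt (by simpa using hcard)
  obtain ⟨v, hv, hv0⟩ := Submodule.exists_mem_ne_zero_of_ne_bot hker
  have hv' : v ᵥ* (P * Rᴴ) = 0 := hv
  set y : Matrix Unit N K := Matrix.replicateRow Unit v with hy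
  have hy0 : y ≠ 0 := by
    intro h
    apply hv0
    ext i
    exact congrFun (congrFun h ()) i
  have hyR : y * P * Rᴴ = 0 := by
    ext i j
    rw [Matrix.mul_assoc]
    exact congrFun hv' j
  obtain ⟨g, hg, hgy⟩ := hP y hy0
  have hg' : star g ≠ 0 := by simpa using hg
  refine ⟨g⁻¹ • y, ?_, ?_⟩
  · rw [conjTranspose_smul, Matrix.smul_mul, Matrix.smul_mul, Matrix.mul_smul, hgy, smul_smul,
      smul_smul, star_inv₀, show g⁻¹ * (star g)⁻¹ * (g * star g) = 1 by field_simp, one_smul]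
  · rw [Matrix.smul_mul, Matrix.smul_mul, hyR, smul_zero]

/-- An orthonormal family of rows extends to one of any size up to the dimension. -/
lemma NormDefinite.exists_orthonormal_extension [DecidableEq ι] {P : Matrix N N K} (hP : NormDefinite P)
    (hPs : Pᴴ = P) {R : Matrix ι N K} (hR : R * P * Rᴴ = 1) (k : ℕ)
    (hcard : Fintype.card ι + k ≤ Fintype.card N) :
    ∃ T : Matrix (Fin k) N K, fromRows R T * P * (fromRows R T)ᴴ = 1 := by
  induction k with
  | zero =>
    refine ⟨0, ?_⟩
    rw [fromRows_mul, conjTranspose_fromRows_eq_fromCols_conjTranspose, fromRows_mul_fromCols, hR,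
      ← fromBlocks_one]
    congr 1 <;> ext i j
    · exact j.elim0
    · exact i.elim0
    · exact i.elim0
  | succ k ih =>
    obtain ⟨T, hT⟩ := ih (by omega)
    obtain ⟨x, hx, hxT⟩ := hP.exists_orthonormal_row (fromRows R T) (by simp; omega)
    have hTx : fromRows R T * P * xᴴ = 0 := by
      have := congrArg conjTranspose hxT
      rwa [conjTranspose_mul, conjTranspose_mul, conjTranspose_conjTranspose, hPs,
        conjTranspose_zero, ← Matrix.mul_assoc] at this
    have hfull : fromRows (fromRows R T) x * P * (fromRows (fromRows R T) x)ᴴ = 1 := by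
      rw [fromRows_mul, conjTranspose_fromRows_eq_fromCols_conjTranspose, fromRows_mul_fromCols,
        hT, hx, hTx, hxT, fromBlocks_one]
    let e : ι ⊕ Fin (k + 1) ≃ (ι ⊕ Fin k) ⊕ Unit :=
      ((Equiv.refl ι).sumCongr
        (finSumFinEquiv.symm.trans ((Equiv.refl (Fin k)).sumCongr finOneEquiv))).trans
        (Equiv.sumAssoc ι (Fin k) Unit).symm
    refine ⟨Matrix.of fun i => fromRows (fromRows R T) x (e (Sum.inr i)), ?_⟩
    have hrows : fromRows R (Matrix.of fun i => fromRows (fromRows R T) x (e (Sum.inr i))) =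
        (fromRows (fromRows R T) x).submatrix e id := by
      ext (i | i) j <;> rfl
    rw [hrows, conjTranspose_submatrix]
    have := congrArg (fun M => M.submatrix e e) hfull
    simp only [submatrix_one_equiv] at this
    rw [← this]
    rfl

/-- A definite matrix factors as `W W†` with `W` square. -/
lemma NormDefinite.exists_eq_mul_conjTranspose {n : ℕ} {P : Matrix (Fin n) (Fin n) K}
    (hP : NormDefinite P) (hPs : Pᴴ = P) :
    ∃ W : Matrix (Fin n) (Fin n) K, P = W * Wᴴ := by
  obtain ⟨T, hT⟩ := hP.exists_orthonormal_extension hPs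
    (R := (0 : Matrix (Fin 0) (Fin n) K)) (by ext i; exact i.elim0) n (by simp)
  rw [fromRows_mul, conjTranspose_fromRows_eq_fromCols_conjTranspose, fromRows_mul_fromCols,
    ← fromBlocks_one, fromBlocks_inj] at hT
  have h1 : T * (P * Tᴴ) = 1 := by rw [← Matrix.mul_assoc]; exact hT.2.2.2
  have h2 : (P * Tᴴ) * T = 1 := mul_eq_one_comm.mp h1
  have hu : IsUnit T.det := Matrix.isUnit_det_of_left_inverse h2
  have hu' : IsUnit Tᴴ.det := by rw [det_conjTranspose]; exact hu.star
  refine ⟨T⁻¹, ?_⟩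
  rw [conjTranspose_nonsing_inv]
  have h4 : P * Tᴴ = T⁻¹ := (Matrix.inv_eq_right_inv h1).symm
  rw [← h4, Matrix.mul_assoc, Matrix.mul_nonsing_inv _ hu', Matrix.mul_one]

end Orthonormal

/-! ### Positivity on the axis -/

variable {p : Type} [Fintype p]

/-- By scalar spectral factorization, positivity on the axis implies definiteness over `ℂ(s)`. -/
lemma normDefinite_of_eventually_posDef {P : TransferMatrix p p}
    (h : ∀ᶠ ω : ℝ in cofinite, (P.evalAt (iAxis ω)).PosDef) : NormDefinite P := by
  intro x hx
  have hev : ∀ᶠ ω : ℝ in cofinite, TransferMatrix.evalAt (x * P * xᴴ) (iAxis ω) =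
      TransferMatrix.evalAt x (iAxis ω) * P.evalAt (iAxis ω) *
        (TransferMatrix.evalAt x (iAxis ω))ᴴ := by
    filter_upwards [TransferMatrix.eventually_not_isPole_iAxis x,
      TransferMatrix.eventually_not_isPole_iAxis P] with ω h1 h2
    rw [TransferMatrix.evalAt_mul_conjTranspose_iAxis (TransferMatrix.not_isPole_mul h1 h2) h1,
      TransferMatrix.evalAt_mul h1 h2]
  have hnonneg : ∀ᶠ ω : ℝ in cofinite,
      0 ≤ ((x * P * xᴴ) () ()).eval (RingHom.id ℂ) (iAxis ω) := by
    filter_upwards [h, hev] with ω h1 h2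
    have := (h1.posSemidef.mul_mul_conjTranspose_same
      (TransferMatrix.evalAt x (iAxis ω))).diag_nonneg (i := ())
    rwa [← h2] at this
  obtain ⟨g, hg⟩ := exists_eq_mul_star hnonneg
  have hgx : x * P * xᴴ = (g * star g) • 1 := by
    ext i j
    simpa using hg
  refine ⟨g, ?_, hgx⟩
  rintro rfl
  apply hx
  apply TransferMatrix.eq_zero_of_eventually_evalAt_eq_zero
  filter_upwards [h, hev] with ω h1 h2
  rw [hgx, zero_mul, zero_smul] at h2
  by_contra hne
  have hv : star (TransferMatrix.evalAt x (iAxis ω) ()) ≠ 0 := by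
    intro h0
    apply hne
    ext i j
    exact congrFun (star_eq_zero.mp h0) j
  have hpos := h1.dotProduct_mulVec_pos hv
  have h3 := congrFun (congrFun h2 ()) ()
  rw [Matrix.mul_assoc, Matrix.mul_apply_eq_vecMul] at h3
  have h4 : TransferMatrix.evalAt (0 : TransferMatrix Unit Unit) (iAxis ω) () () = 0 := by
    simp [TransferMatrix.evalAt]
  rw [h4] at h3
  rw [star_star] at hpos
  refine hpos.ne ?_
  rw [h3]
  rfl

/-! ### Growth of rational functions -/

open Bornology Asymptotics in
lemma natDegree_le_of_isBigO {p q : ℂ[X]} {l : Filter ℂ} [l.NeBot] (hl : l ≤ cobounded ℂ)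
    (h : (fun z => p.eval z) =O[l] fun z => q.eval z) : p.natDegree ≤ q.natDegree := by
  by_contra! hlt
  have hp : p ≠ 0 := by rintro rfl; simp at hlt
  have hdeg : q.degree < p.degree := degree_lt_degree hlt
  have h1 : (fun z => q.eval z) =o[l] fun z => p.eval z :=
    (isLittleO_cobounded_of_degree_lt hdeg).mono hl
  refine isLittleO_irrefl ?_ (h.trans_isLittleO h1)
  have h2 : ∀ᶠ z in l, p.eval z ≠ 0 :=
    (hl.trans (Bornology.le_cofinite ℂ)) (eventually_cofinite_not_isRoot hp)
  exact h2.frequently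

lemma tendsto_iAxis_cobounded : Tendsto iAxis (cocompact ℝ) (Bornology.cobounded ℂ) := by
  rw [← tendsto_norm_atTop_iff_cobounded]
  have : (fun ω : ℝ => ‖iAxis ω‖) = fun ω : ℝ => ‖ω‖ := by
    ext ω
    simp [iAxis]
  rw [this]
  exact tendsto_norm_cocompact_atTop

lemma norm_num_le_of_eventually {f : RatFunc ℂ} {M : ℝ}
    (h : ∀ᶠ ω : ℝ in cofinite, ‖f.eval (RingHom.id ℂ) (iAxis ω)‖ ≤ M) (ω : ℝ) :
    ‖f.num.eval (iAxis ω)‖ ≤ M * ‖f.denom.eval (iAxis ω)‖ := by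
  refine forall_mem_of_eventually_cofinite
    (C := {ω : ℝ | ‖f.num.eval (iAxis ω)‖ ≤ M * ‖f.denom.eval (iAxis ω)‖})
    (isClosed_le (continuous_eval_iAxis _).norm
      (continuous_const.mul (continuous_eval_iAxis _).norm)) ?_ ω
  filter_upwards [h, eventually_regularAt_iAxis f] with ω h1 h2
  rw [eval_eq_num_div_denom, norm_div, div_le_iff₀ (norm_pos_iff.mpr h2)] at h1
  exact h1

/-- A rational function that is bounded on the axis has no pole there. -/
lemma regularAt_iAxis_of_bounded {f : RatFunc ℂ} {M : ℝ}
    (h : ∀ᶠ ω : ℝ in cofinite, ‖f.eval (RingHom.id ℂ) (iAxis ω)‖ ≤ M) (ω : ℝ) :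
    RegularAt f (iAxis ω) := by
  intro h0
  have h1 := norm_num_le_of_eventually h ω
  rw [h0, norm_zero, mul_zero] at h1
  have h2 : f.num.eval (iAxis ω) = 0 := norm_le_zero_iff.mp h1
  obtain ⟨a, b, hab⟩ := RatFunc.isCoprime_num_denom f
  have := congrArg (Polynomial.eval (iAxis ω)) hab
  simp [h0, h2] at this

/-- A rational function that is bounded on the axis is proper. -/
lemma natDegree_num_le_of_bounded {f : RatFunc ℂ} {M : ℝ}
    (h : ∀ᶠ ω : ℝ in cofinite, ‖f.eval (RingHom.id ℂ) (iAxis ω)‖ ≤ M) :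
    f.num.natDegree ≤ f.denom.natDegree := by
  have : (map iAxis (cocompact ℝ)).NeBot := inferInstance
  refine natDegree_le_of_isBigO (l := map iAxis (cocompact ℝ)) tendsto_iAxis_cobounded ?_
  exact Asymptotics.IsBigO.of_bound M
    (eventually_map.mpr (Eventually.of_forall (norm_num_le_of_eventually h)))

/-- A proper rational function has a limit at infinity. -/
lemma exists_tendsto_iAxis {f : RatFunc ℂ} (h : f.num.natDegree ≤ f.denom.natDegree) :
    ∃ L : ℂ, Tendsto (fun ω : ℝ => f.eval (RingHom.id ℂ) (iAxis ω)) (cocompact ℝ) (𝓝 L) := by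
  set q := f.denom with hq
  have hq0 : q ≠ 0 := RatFunc.denom_ne_zero f
  -- Subtracting the quotient `L` of the coefficients at degree `deg q` leaves degree `< deg q`.
  set L : ℂ := f.num.coeff q.natDegree / q.leadingCoeff with hL
  have hlc : q.leadingCoeff ≠ 0 := leadingCoeff_ne_zero.mpr hq0
  have hdeg : (f.num - C L * q).degree < q.degree := by
    rw [degree_eq_natDegree hq0, degree_lt_iff_coeff_zero]
    intro k hk
    rw [coeff_sub, coeff_C_mul]
    rcases hk.eq_or_lt with rfl | hk
    · rw [hL, ← leadingCoeff, div_mul_cancel₀ _ hlc, sub_self]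
    · rw [coeff_eq_zero_of_natDegree_lt hk, coeff_eq_zero_of_natDegree_lt (h.trans_lt hk)]
      simp
  have ho := ((isLittleO_cobounded_of_degree_lt hdeg).comp_tendsto
    tendsto_iAxis_cobounded).tendsto_div_nhds_zero
  refine ⟨L, ?_⟩
  have hne : ∀ᶠ ω : ℝ in cocompact ℝ, q.eval (iAxis ω) ≠ 0 :=
    tendsto_iAxis_cobounded.eventually
      (Bornology.le_cofinite ℂ (eventually_cofinite_not_isRoot hq0))
  have := ho.add_const L
  rw [zero_add] at this
  refine this.congr' ?_
  filter_upwards [hne] with ω hω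
  simp only [Function.comp, eval_sub, eval_mul, eval_C, eval_eq_num_div_denom, ← hq]
  field_simp
  ring

/-- A proper rational function without poles in the closed right half-plane is bounded there. -/
lemma exists_norm_le_of_regularAt {f : RatFunc ℂ} (h : f.num.natDegree ≤ f.denom.natDegree)
    (hreg : ∀ s : ℂ, 0 ≤ s.re → RegularAt f s) :
    ∃ M : ℝ, ∀ s : ℂ, 0 ≤ s.re → ‖f.eval (RingHom.id ℂ) s‖ ≤ M := by
  have hd : f.num.degree ≤ f.denom.degree := by
    rw [degree_eq_natDegree (RatFunc.denom_ne_zero f)]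
    exact degree_le_natDegree.trans (by exact_mod_cast h)
  obtain ⟨c, hc⟩ := (isBigO_cobounded_of_degree_le hd).bound
  rw [← comap_norm_atTop, eventually_comap, eventually_atTop] at hc
  obtain ⟨r, hr⟩ := hc
  have hK : IsCompact (Metric.closedBall (0 : ℂ) r ∩ {s | 0 ≤ s.re}) :=
    (isCompact_closedBall 0 r).inter_right (isClosed_le continuous_const Complex.continuous_re)
  have hcont : ContinuousOn (fun s => f.eval (RingHom.id ℂ) s)
      (Metric.closedBall (0 : ℂ) r ∩ {s | 0 ≤ s.re}) := by
    simp only [eval_eq_num_div_denom]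
    exact f.num.continuous.continuousOn.div f.denom.continuous.continuousOn
      fun s hs => hreg s hs.2
  obtain ⟨M, hM⟩ := hK.exists_bound_of_continuousOn hcont
  refine ⟨max c M, fun s hs => ?_⟩
  by_cases hsr : ‖s‖ ≤ r
  · exact (hM s ⟨by simpa using hsr, hs⟩).trans (le_max_right _ _)
  · refine le_trans ?_ (le_max_left _ _)
    rw [eval_eq_num_div_denom, norm_div, div_le_iff₀ (norm_pos_iff.mpr (hreg s hs))]
    exact hr ‖s‖ (not_le.mp hsr).le s rfl

namespace TransferMatrix

variable {p q : Type} [Fintype p] [Fintype q]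

lemma isStable_of_forall_isPole {H : TransferMatrix p q} (h : ∀ s, H.IsPole s → s.re < 0) :
    H.IsStable := by
  refine ⟨h, ?_⟩
  have hev : ∀ᶠ τ : ℝ in 𝓝[>] 0, ∀ s ∈ {s | H.IsPole s}, s.re < -τ := by
    rw [eventually_all_finite (finite_setOf_isPole H)]
    intro s hs
    have h1 : ∀ᶠ τ : ℝ in 𝓝 0, τ < -s.re := eventually_lt_nhds (by linarith [h s hs])
    filter_upwards [nhdsWithin_le_nhds h1] with τ hτ
    linarith
  obtain ⟨τ, hτ, hτ0⟩ := (hev.and self_mem_nhdsWithin).exists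
  exact ⟨τ, hτ0, fun s hs hp => absurd (hτ s hp) (not_lt.mpr hs.le)⟩

omit [Fintype p] [Fintype q] in
lemma IsStable.not_isPole {H : TransferMatrix p q} (h : H.IsStable) {s : ℂ} (hs : 0 ≤ s.re) :
    ¬ H.IsPole s := fun hp => absurd (h.1 s hp) (not_lt.mpr hs)

omit [Fintype p] [Fintype q] in
lemma IsStable.not_isPole_iAxis {H : TransferMatrix p q} (h : H.IsStable) (ω : ℝ) :
    ¬ H.IsPole (iAxis ω) := h.not_isPole (iAxis_re ω).ge

lemma IsStable.isHardyInfty {H : TransferMatrix p q} (h : H.IsStable) (hp : H.IsProper) :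
    H.IsHardyInfty := by
  refine ⟨fun s hs => h.not_isPole hs.le, ?_⟩
  choose M hM using fun i j => exists_norm_le_of_regularAt (hp i j) fun s hs =>
    not_isPole_iff.mp (h.not_isPole hs) i j
  refine ⟨∑ i, ∑ j, |M i j|, fun s hs i j => (hM i j s hs.le).trans ?_⟩
  calc M i j ≤ |M i j| := le_abs_self _
    _ ≤ ∑ j, |M i j| :=
      Finset.single_le_sum (f := fun j => |M i j|) (fun _ _ => abs_nonneg _) (Finset.mem_univ j)
    _ ≤ _ := Finset.single_le_sum (f := fun i => ∑ j, |M i j|)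
      (fun _ _ => Finset.sum_nonneg fun _ _ => abs_nonneg _) (Finset.mem_univ i)

omit [Fintype p] [Fintype q] in
lemma IsHardyInfty.isProper {H : TransferMatrix p q} (h : H.IsHardyInfty) : H.IsProper := by
  obtain ⟨hreg, M, hM⟩ := h
  intro i j
  have hl : Tendsto (fun x : ℝ => (x : ℂ)) atTop (Bornology.cobounded ℂ) := by
    rw [← tendsto_norm_atTop_iff_cobounded]
    simpa using tendsto_abs_atTop_atTop
  refine natDegree_le_of_isBigO (l := map (fun x : ℝ => (x : ℂ)) atTop) hl ?_
  refine Asymptotics.IsBigO.of_bound M (eventually_map.mpr ?_)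
  filter_upwards [eventually_gt_atTop 0] with x hx
  have hre : 0 < (x : ℂ).re := by simpa using hx
  have h1 := hM x hre i j
  have h2 := not_isPole_iff.mp (hreg x hre) i j
  rwa [evalAt, eval_eq_num_div_denom, norm_div, div_le_iff₀ (norm_pos_iff.mpr h2)] at h1

end TransferMatrix

/-! ### Cancellation of unstable poles -/

/-- Separation of the zeros of a polynomial in the open right half-plane from the others. -/
lemma exists_eq_mul_of_re {d : ℂ[X]} (hd : d ≠ 0) :
    ∃ a b : ℂ[X], d = a * b ∧ (∀ s, a.eval s = 0 → 0 < s.re) ∧ ∀ s, b.eval s = 0 → s.re ≤ 0 := by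
  induction hn : d.natDegree generalizing d with
  | zero =>
    obtain ⟨c, rfl⟩ := natDegree_eq_zero.mp hn
    refine ⟨1, C c, by simp, by simp, fun s hs => ?_⟩
    simp at hs
    simp [hs] at hd
  | succ n ih =>
    obtain ⟨z, hz⟩ := IsAlgClosed.exists_root d (by
      rw [degree_eq_natDegree hd, hn]
      exact_mod_cast n.succ_ne_zero)
    obtain ⟨t, rfl⟩ := dvd_iff_isRoot.mpr hz
    have ht : t ≠ 0 := right_ne_zero_of_mul hd
    rw [natDegree_mul (X_sub_C_ne_zero z) ht, natDegree_X_sub_C] at hn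
    obtain ⟨a, b, rfl, ha, hb⟩ := ih ht (by omega)
    by_cases hre : 0 < z.re
    · refine ⟨(X - C z) * a, b, by ring, fun s hs => ?_, hb⟩
      rw [eval_mul, mul_eq_zero] at hs
      rcases hs with hs | hs
      · have : s = z := by simpa [sub_eq_zero] using hs
        rwa [this]
      · exact ha s hs
    · refine ⟨a, (X - C z) * b, by ring, ha, fun s hs => ?_⟩
      rw [eval_mul, mul_eq_zero] at hs
      rcases hs with hs | hs
      · have : s = z := by simpa [sub_eq_zero] using hs
        rw [this]
        exact not_lt.mp hre
      · exact hb s hs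

/-- The poles of a transfer matrix in the open right half-plane can be cancelled by a scalar
all-pass factor (a Blaschke product). -/
lemma exists_allPass_regularAt {p q : Type} [Fintype p] [Fintype q] (M : TransferMatrix p q) :
    ∃ b : RatFunc ℂ, b * star b = 1 ∧ ∀ s : ℂ, 0 < s.re → ∀ i j, RegularAt (b * M i j) s := by
  set d : ℂ[X] := ∏ i, ∏ j, (M i j).denom with hd
  have hd0 : d ≠ 0 :=
    Finset.prod_ne_zero_iff.mpr fun i _ => Finset.prod_ne_zero_iff.mpr fun j _ =>
      RatFunc.denom_ne_zero _
  have hdvd : ∀ i j, (M i j).denom ∣ d := fun i j =>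
    (Finset.dvd_prod_of_mem (fun j => (M i j).denom) (Finset.mem_univ j)).trans
      (Finset.dvd_prod_of_mem (fun i => ∏ j, (M i j).denom) (Finset.mem_univ i))
  obtain ⟨a, c, hac, ha, hc⟩ := exists_eq_mul_of_re hd0
  have ha0 : a ≠ 0 := by rintro rfl; simp [hd0] at hac
  have hc0 : c ≠ 0 := by rintro rfl; simp [hd0] at hac
  have ha0' : polyConj a ≠ 0 := by rwa [Ne, map_eq_zero_iff _ polyConj_injective]
  have haK : algebraMap ℂ[X] (RatFunc ℂ) a ≠ 0 := RatFunc.algebraMap_ne_zero ha0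
  have hcK : algebraMap ℂ[X] (RatFunc ℂ) c ≠ 0 := RatFunc.algebraMap_ne_zero hc0
  have haK' : algebraMap ℂ[X] (RatFunc ℂ) (polyConj a) ≠ 0 := RatFunc.algebraMap_ne_zero ha0'
  -- The common denominator is `d = a c` with `a` containing the zeros to be cancelled; `a / a^H`
  -- replaces them by their mirror images in the left half-plane.
  refine ⟨algebraMap ℂ[X] (RatFunc ℂ) a / algebraMap ℂ[X] (RatFunc ℂ) (polyConj a), ?_, ?_⟩
  · rw [star_algebraMap_div, polyConj_polyConj]
    field_simp
  · intro s hs i j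
    obtain ⟨e, he⟩ := hdvd i j
    have hrK : algebraMap ℂ[X] (RatFunc ℂ) (M i j).denom ≠ 0 :=
      RatFunc.algebraMap_ne_zero (RatFunc.denom_ne_zero _)
    have hprod : algebraMap ℂ[X] (RatFunc ℂ) a * algebraMap ℂ[X] (RatFunc ℂ) c =
        algebraMap ℂ[X] (RatFunc ℂ) (M i j).denom * algebraMap ℂ[X] (RatFunc ℂ) e := by
      rw [← map_mul, ← map_mul, ← hac, he]
    have heq : algebraMap ℂ[X] (RatFunc ℂ) a / algebraMap ℂ[X] (RatFunc ℂ) (polyConj a) * M i j =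
        algebraMap ℂ[X] (RatFunc ℂ) ((M i j).num * e) /
          algebraMap ℂ[X] (RatFunc ℂ) (c * polyConj a) := by
      conv_lhs => rw [← RatFunc.num_div_denom (M i j)]
      rw [map_mul, map_mul, div_mul_div_comm, div_eq_div_iff (mul_ne_zero haK' hrK)
        (mul_ne_zero hcK haK')]
      linear_combination (algebraMap ℂ[X] (RatFunc ℂ) (M i j).num *
        algebraMap ℂ[X] (RatFunc ℂ) (polyConj a)) * hprod
    rw [heq]
    apply RegularAt.of_div
    rw [eval_mul, eval_polyConj]
    refine mul_ne_zero (fun h => ?_) (fun h => ?_)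
    · exact absurd (hc s h) (not_le.mpr hs)
    · have := ha _ ((map_eq_zero _).mp h)
      simp at this
      linarith

/-! ### Embedding of a strict contraction in a paraunitary matrix -/

lemma regularAt_sub {f g : RatFunc ℂ} {s : ℂ} (hf : RegularAt f s) (hg : RegularAt g s) :
    RegularAt (f - g) s ∧ (f - g).eval (RingHom.id ℂ) s =
      f.eval (RingHom.id ℂ) s - g.eval (RingHom.id ℂ) s := by
  have hneg : f - g = f + algebraMap ℂ[X] (RatFunc ℂ) (-1) * g := by
    rw [map_neg, map_one]
    ring
  have h1 := RegularAt.algebraMap (-1) s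
  have he : (algebraMap ℂ[X] (RatFunc ℂ) (-1)).eval (RingHom.id ℂ) s = -1 := by
    rw [RatFunc.eval_algebraMap]
    simp
  rw [hneg, hf.eval_add (h1.mul hg), h1.eval_mul hg, he, neg_one_mul, ← sub_eq_add_neg]
  exact ⟨hf.add (h1.mul hg), rfl⟩

namespace TransferMatrix

variable {p q : Type}

lemma evalAt_one_sub [DecidableEq p] {M : TransferMatrix p p} {s : ℂ} (hM : ¬ M.IsPole s) :
    evalAt (1 - M) s = 1 - evalAt M s := by
  ext i j
  have h := (regularAt_sub (not_isPole_iff.mp not_isPole_one i j) (not_isPole_iff.mp hM i j)).2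
  have h1 := congrFun (congrFun (evalAt_one (p := p) (s := s)) i) j
  rw [Matrix.sub_apply]
  rw [← h1]
  exact h

lemma norm_apply_le_one_of_mul_conjTranspose [Fintype q] [DecidableEq p] {M : Matrix p q ℂ}
    (h : M * Mᴴ = 1) (i : p) (j : q) : ‖M i j‖ ≤ 1 := by
  have h1 := congrFun (congrFun h i) i
  simp only [Matrix.mul_apply, conjTranspose_apply, one_apply_eq, RCLike.star_def,
    Complex.mul_conj] at h1
  have h2 : ∑ k, Complex.normSq (M i k) = 1 := by exact_mod_cast h1
  have h3 : Complex.normSq (M i j) ≤ 1 := by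
    rw [← h2]
    exact Finset.single_le_sum (f := fun k => Complex.normSq (M i k))
      (fun k _ => Complex.normSq_nonneg _) (Finset.mem_univ j)
  rw [Complex.normSq_eq_norm_sq] at h3
  exact (sq_le_one_iff₀ (norm_nonneg (M i j))).mp h3

/-- A co-isometric matrix over `ℂ(s)` is bounded on the axis, hence proper and without poles there;
so analyticity in the open right half-plane is all that its stability requires. -/
lemma isStable_isProper_of_mul_conjTranspose [Fintype p] [Fintype q] [DecidableEq p]
    {H : TransferMatrix p q} (hH : H * Hᴴ = 1) (hreg : ∀ s : ℂ, 0 < s.re → ¬ H.IsPole s) :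
    H.IsStable ∧ H.IsProper := by
  have hb : ∀ i j, ∀ᶠ ω : ℝ in cofinite, ‖(H i j).eval (RingHom.id ℂ) (iAxis ω)‖ ≤ 1 := by
    intro i j
    filter_upwards [eventually_not_isPole_iAxis H] with ω hω
    have h1 := evalAt_mul_conjTranspose_iAxis hω hω
    rw [hH, evalAt_one] at h1
    exact norm_apply_le_one_of_mul_conjTranspose h1.symm i j
  refine ⟨isStable_of_forall_isPole fun s hs => ?_, fun i j => natDegree_num_le_of_bounded (hb i j)⟩
  by_contra! h
  rcases h.eq_or_lt with h | h
  · rw [eq_iAxis_of_re_eq_zero h.symm] at hs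
    obtain ⟨i, j, hij⟩ := hs
    exact regularAt_iAxis_of_bounded (hb i j) _ hij
  · exact hreg s h hs

lemma isParaunitary_of_mul_conjTranspose [Fintype p] [Fintype q] [DecidableEq p] [DecidableEq q]
    {H : TransferMatrix p q} (h1 : H * Hᴴ = 1) (h2 : Hᴴ * H = 1) : H.IsParaunitary := by
  intro s hs hs'
  rw [← evalAt_conjTranspose hs', ← evalAt_mul (not_isPole_conjTranspose hs') hs,
    ← evalAt_mul hs (not_isPole_conjTranspose hs'), h1, h2, evalAt_one, evalAt_one]
  exact ⟨rfl, rfl⟩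

end TransferMatrix

open TransferMatrix

lemma smul_mul_conjTranspose_smul {p q r : Type} [Fintype q] {b : RatFunc ℂ} (hb : b * star b = 1)
    (M : TransferMatrix p q) (N : TransferMatrix r q) : (b • M) * (b • N)ᴴ = M * Nᴴ := by
  rw [conjTranspose_smul, Matrix.smul_mul, Matrix.mul_smul, smul_smul, hb, one_smul]

/-- A stable transfer matrix `F` with `F(iω) F(iω)† < I` is the upper left block of an admissible
equalizer. -/
theorem exists_isAdmissible {n ny : ℕ} {F : TransferMatrix (Fin n) (Fin ny)} (hF : F.IsStable)
    (hpos : ∀ ω : ℝ, (1 - F.evalAt (iAxis ω) * (F.evalAt (iAxis ω))ᴴ).PosDef) :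
    ∃ H : TransferMatrix (Fin n ⊕ Fin ny) (Fin ny ⊕ Fin n), IsAdmissible H ∧
      H.toBlocks₁₁ = F := by
  have hdef : NormDefinite (1 - F * Fᴴ) := by
    apply normDefinite_of_eventually_posDef
    refine Eventually.of_forall fun ω => ?_
    have h1 := hF.not_isPole_iAxis ω
    rw [evalAt_one_sub (not_isPole_mul h1 (not_isPole_conjTranspose (by rwa [neg_conj_iAxis]))),
      evalAt_mul_conjTranspose_iAxis h1 h1]
    exact hpos ω
  obtain ⟨W, hW⟩ := hdef.exists_eq_mul_conjTranspose (by simp [conjTranspose_sub])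
  obtain ⟨b, hb, hbW⟩ := exists_allPass_regularAt W
  set R := fromCols F (b • W) with hR
  have hRR : R * (1 : TransferMatrix (Fin ny ⊕ Fin n) (Fin ny ⊕ Fin n)) * Rᴴ = 1 := by
    rw [Matrix.mul_one, hR, conjTranspose_fromCols_eq_fromRows_conjTranspose,
      fromCols_mul_fromRows, smul_mul_conjTranspose_smul hb, ← hW, add_sub_cancel]
  have hone : NormDefinite (1 : TransferMatrix (Fin ny ⊕ Fin n) (Fin ny ⊕ Fin n)) := by
    apply normDefinite_of_eventually_posDef
    refine Eventually.of_forall fun ω => ?_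
    rw [evalAt_one]
    exact PosDef.one
  obtain ⟨T, hT⟩ := hone.exists_orthonormal_extension conjTranspose_one hRR ny
    (by simp [add_comm])
  obtain ⟨c, hc, hcT⟩ := exists_allPass_regularAt T
  rw [Matrix.mul_one, conjTranspose_fromRows_eq_fromCols_conjTranspose, fromRows_mul_fromCols,
    ← fromBlocks_one, fromBlocks_inj] at hT
  obtain ⟨hT1, hT2, hT3, hT4⟩ := hT
  set H : TransferMatrix (Fin n ⊕ Fin ny) (Fin ny ⊕ Fin n) := fromRows R (c • T) with hH
  have hHH : H * Hᴴ = 1 := by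
    rw [hH, conjTranspose_fromRows_eq_fromCols_conjTranspose, fromRows_mul_fromCols,
      smul_mul_conjTranspose_smul hc, hT1, hT4, conjTranspose_smul, Matrix.mul_smul, hT2,
      Matrix.smul_mul, hT3, smul_zero, smul_zero, fromBlocks_one]
  have hHH' : Hᴴ * H = 1 :=
    (Matrix.mul_eq_one_comm_of_equiv (Equiv.sumComm (Fin n) (Fin ny))).mp hHH
  have hreg : ∀ s : ℂ, 0 < s.re → ¬ H.IsPole s := by
    intro s hs
    rw [not_isPole_iff]
    rintro (i | i) j
    · rcases j with j | j
      · exact not_isPole_iff.mp (hF.not_isPole hs.le) i j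
      · exact hbW s hs i j
    · exact hcT s hs i j
  obtain ⟨hst, hpr⟩ := isStable_isProper_of_mul_conjTranspose hHH hreg
  refine ⟨H, ⟨add_comm n ny, hst.isHardyInfty hpr, hst,
    isParaunitary_of_mul_conjTranspose hHH hHH'⟩, ?_⟩
  ext i j
  rfl

/-! ### Congruence by `[X I]` -/

lemma congruence_identity {p q : Type} [Fintype p] [Fintype q] [DecidableEq p] [DecidableEq q]
    (X : Matrix p q ℂ) (Φ : Matrix (q ⊕ p) (q ⊕ p) ℂ) (γ θ : ℝ) :
    1 - X * Xᴴ = θ • (γ ^ 2 • (1 : Matrix p p ℂ) - fromCols X (1 : Matrix p p ℂ) * Φ *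
        fromRows Xᴴ (1 : Matrix p p ℂ)) +
      fromCols X (1 : Matrix p p ℂ) *
        (θ • (Φ - γ ^ 2 • (fromBlocks 0 0 0 1 : Matrix (q ⊕ p) (q ⊕ p) ℂ))
        - (fromBlocks 1 0 0 (-1) : Matrix (q ⊕ p) (q ⊕ p) ℂ)) *
        (fromCols X (1 : Matrix p p ℂ))ᴴ := by
  rw [conjTranspose_fromCols_eq_fromRows_conjTranspose, conjTranspose_one]
  have h1 : fromCols X (1 : Matrix p p ℂ) * (fromBlocks 0 0 0 1 : Matrix (q ⊕ p) (q ⊕ p) ℂ) *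
      fromRows Xᴴ (1 : Matrix p p ℂ) = (1 : Matrix p p ℂ) := by
    rw [fromCols_mul_fromBlocks, fromCols_mul_fromRows]
    simp
  have h2 : fromCols X (1 : Matrix p p ℂ) * (fromBlocks 1 0 0 (-1) : Matrix (q ⊕ p) (q ⊕ p) ℂ) *
      fromRows Xᴴ (1 : Matrix p p ℂ) = X * Xᴴ - 1 := by
    rw [fromCols_mul_fromBlocks, fromCols_mul_fromRows]
    simp [sub_eq_add_neg]
  simp only [Matrix.mul_sub, Matrix.sub_mul, Matrix.mul_smul, Matrix.smul_mul, h1, h2, smul_sub]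
  abel

lemma continuous_fromCols_one {p q : Type} [DecidableEq p] :
    Continuous fun Z : Matrix p q ℂ => fromCols Z (1 : Matrix p p ℂ) := by
  refine continuous_matrix ?_
  rintro i (j | j)
  · exact continuous_id.matrix_elem i j
  · exact continuous_const

lemma continuous_congr {p q : Type} [Fintype q] :
    Continuous fun Z : Matrix p q ℂ × Matrix q q ℂ => Z.1 * Z.2 * Z.1ᴴ := by fun_prop

lemma tendsto_congr_fromCols {p q : Type} [Fintype p] [Fintype q] [DecidableEq p]
    {Y : ℝ → Matrix p q ℂ} {M : ℝ → Matrix (q ⊕ p) (q ⊕ p) ℂ} {X : Matrix p q ℂ}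
    {L : Matrix (q ⊕ p) (q ⊕ p) ℂ} {l : Filter ℝ} (hY : Tendsto Y l (𝓝 X))
    (hM : Tendsto M l (𝓝 L)) :
    Tendsto (fun ω => fromCols (Y ω) (1 : Matrix p p ℂ) * M ω *
      (fromCols (Y ω) (1 : Matrix p p ℂ))ᴴ) l
      (𝓝 (fromCols X (1 : Matrix p p ℂ) * L * (fromCols X (1 : Matrix p p ℂ))ᴴ)) := by
  have h1 : Tendsto (fun ω => (fromCols (Y ω) (1 : Matrix p p ℂ), M ω)) l
      (𝓝 (fromCols X (1 : Matrix p p ℂ), L)) :=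
    ((continuous_fromCols_one.tendsto X).comp hY).prodMk_nhds hM
  have h2 := (continuous_congr.tendsto (fromCols X (1 : Matrix p p ℂ), L)).comp h1
  exact h2

lemma posDef_congr_fromCols {p q : Type} [Fintype p] [Fintype q] [DecidableEq p]
    {M : Matrix (q ⊕ p) (q ⊕ p) ℂ} (hM : M.PosDef) (X : Matrix p q ℂ) :
    (fromCols X (1 : Matrix p p ℂ) * M * (fromCols X (1 : Matrix p p ℂ))ᴴ).PosDef := by
  refine hM.mul_mul_conjTranspose_same ?_
  intro v w hvw
  ext i
  have := congrFun hvw (Sum.inr i)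
  simpa [vecMul_fromCols] using this

lemma tendsto_evalAt_iAxis {p q : Type} {F : TransferMatrix p q} (hF : F.IsProper) :
    ∃ L : Matrix p q ℂ, Tendsto (fun ω : ℝ => F.evalAt (iAxis ω)) (cocompact ℝ) (𝓝 L) := by
  choose L hL using fun i j => exists_tendsto_iAxis (hF i j)
  exact ⟨L, tendsto_pi_nhds.mpr fun i => tendsto_pi_nhds.mpr fun j => hL i j⟩

lemma posSemidef_of_tendsto {p : Type} [Fintype p] {F : ℝ → Matrix p p ℂ} {L : Matrix p p ℂ}
    {l : Filter ℝ} [l.NeBot] (hF : Tendsto F l (𝓝 L)) (h : ∀ ω, (F ω).PosSemidef) :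
    L.PosSemidef := by
  refine PosSemidef.of_dotProduct_mulVec_nonneg ?_ fun x => ?_
  · exact tendsto_nhds_unique
      (((continuous_id.matrix_conjTranspose).tendsto L |>.comp hF).congr fun ω => (h ω).1) hF
  · have hc : Continuous fun M : Matrix p p ℂ => star x ⬝ᵥ M *ᵥ x := by fun_prop
    exact ge_of_tendsto' ((hc.tendsto L).comp hF) fun ω => (h ω).dotProduct_mulVec_nonneg x

/-- The error spectrum of a co-isometric filter `[h z]` behind a co-isometric channel `[G g]`, as a
function of `h` alone. -/
lemma error_expansion {n ny nw nz : Type*} [Fintype n] [Fintype ny] [Fintype nw] [Fintype nz]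
    [DecidableEq n] [DecidableEq ny] [DecidableEq nw] {h : Matrix n ny ℂ} {z : Matrix n nz ℂ}
    {G : Matrix ny n ℂ} {g : Matrix ny nw ℂ} (U : Matrix n n ℂ) (V : Matrix nw nw ℂ)
    (hz : h * hᴴ + z * zᴴ = 1) (hG : G * Gᴴ + g * gᴴ = 1) :
    (h * G - 1) * (1 + U) * (h * G - 1)ᴴ + h * g * (1 + V) * (h * g)ᴴ + z * zᴴ =
      fromCols h (1 : Matrix n n ℂ) *
        fromBlocks (G * U * Gᴴ + g * V * gᴴ) (-(G * (1 + U))) (-((1 + U) * Gᴴ))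
          (U + 2 • (1 : Matrix n n ℂ)) * fromRows hᴴ (1 : Matrix n n ℂ) := by
  rw [fromCols_mul_fromBlocks, fromCols_mul_fromRows]
  have key : h * (g * (gᴴ * hᴴ)) = h * hᴴ - h * (G * (Gᴴ * hᴴ)) := by
    rw [eq_sub_iff_add_eq', ← Matrix.mul_add, ← Matrix.mul_assoc, ← Matrix.mul_assoc,
      ← Matrix.add_mul, hG, Matrix.one_mul]
  rw [eq_sub_of_add_eq' hz]
  simp only [conjTranspose_sub, conjTranspose_mul, conjTranspose_one, Matrix.mul_add,
    Matrix.add_mul, Matrix.mul_sub, Matrix.sub_mul, Matrix.mul_one, Matrix.one_mul,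
    Matrix.mul_neg, Matrix.neg_mul, Matrix.mul_assoc, key, two_smul]
  abel

namespace Channel

variable {m n nw ny nd : ℕ} {S : Channel m n nw ny nd}

/-! ### The channel is all-pass on the axis -/

/-- By controllability, `A` has no eigenvalue on the imaginary axis: a left eigenvector there is
annihilated by `B` because of the Lyapunov equation. -/
lemma isUnit_det_resolvent (hreal : S.IsPhysicallyRealizable) (hmin : S.IsMinimal) (ω : ℝ) :
    IsUnit (iAxis ω • 1 - S.A).det := by
  rw [isUnit_iff_ne_zero]
  intro hdet
  obtain ⟨v, hv0, hv⟩ := exists_vecMul_eq_zero_iff.mpr hdet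
  have hvA : v ᵥ* S.A = iAxis ω • v := by
    rw [vecMul_sub, vecMul_smul, vecMul_one, sub_eq_zero] at hv
    exact hv.symm
  have hvB : v ᵥ* S.B = 0 := by
    have h1 : v ᵥ* (S.A + S.Aᴴ + S.B * S.Bᴴ) ⬝ᵥ star v = 0 := by
      rw [hreal.lyapunov, vecMul_zero, zero_dotProduct]
    have h2 : v ᵥ* S.Aᴴ ⬝ᵥ star v = -(iAxis ω * (v ⬝ᵥ star v)) := by
      have h3 : S.Aᴴ *ᵥ star v = star (iAxis ω • v) := by rw [← star_vecMul, hvA]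
      rw [← dotProduct_mulVec, h3, star_smul, dotProduct_smul, smul_eq_mul,
        show star (iAxis ω) = -iAxis ω from neg_eq_iff_eq_neg.mp (neg_conj_iAxis ω), neg_mul]
    have h4 : v ᵥ* (S.B * S.Bᴴ) ⬝ᵥ star v = v ᵥ* S.B ⬝ᵥ star (v ᵥ* S.B) := by
      rw [← vecMul_vecMul, ← dotProduct_mulVec, star_vecMul]
    rw [vecMul_add, vecMul_add, add_dotProduct, add_dotProduct, h2, h4, hvA, smul_dotProduct,
      smul_eq_mul, add_neg_cancel, zero_add] at h1
    exact dotProduct_self_star_eq_zero.mp h1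
  have hvAk : ∀ k : ℕ, v ᵥ* (S.A ^ k * S.B) = 0 := by
    intro k
    have h1 : v ᵥ* (S.A ^ k) = iAxis ω ^ k • v := by
      induction k with
      | zero => simp
      | succ k ih => rw [pow_succ, ← vecMul_vecMul, ih, smul_vecMul, hvA, smul_smul, pow_succ]
    rw [← vecMul_vecMul, h1, smul_vecMul, hvB, smul_zero]
  have hall : ∀ x : Fin m → ℂ, v ⬝ᵥ x = 0 := by
    intro x
    have hx : x ∈ Submodule.span ℂ
        {x : Fin m → ℂ | ∃ k < m, ∃ j : Fin n ⊕ Fin nw, x = (S.A ^ k * S.B).col j} := by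
      rw [hmin.controllable]
      trivial
    induction hx using Submodule.span_induction with
    | mem x hx =>
      obtain ⟨k, -, j, rfl⟩ := hx
      exact congrFun (hvAk k) j
    | zero => exact dotProduct_zero v
    | add x y _ _ hx hy => rw [dotProduct_add, hx, hy, add_zero]
    | smul a x _ hx => rw [dotProduct_smul, hx, smul_zero]
  exact hv0 (dotProduct_self_star_eq_zero.mp (hall (star v)))

/-- `[G₁₁ G₁₂]` is co-isometric on the imaginary axis. -/
lemma G₁₁_mul_add_G₁₂_mul (hreal : S.IsPhysicallyRealizable) (hmin : S.IsMinimal) (ω : ℝ) :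
    S.G₁₁ (iAxis ω) * (S.G₁₁ (iAxis ω))ᴴ + S.G₁₂ (iAxis ω) * (S.G₁₂ (iAxis ω))ᴴ = 1 := by
  set M := iAxis ω • 1 - S.A with hM
  have hu : IsUnit M.det := isUnit_det_resolvent hreal hmin ω
  have hu' : IsUnit Mᴴ.det := by rw [det_conjTranspose]; exact hu.star
  set D₁ := fromCols S.D₁₁ S.D₁₂ with hD₁
  have hDB : S.D * S.Bᴴ = -S.C := by
    rw [hreal.coupling, conjTranspose_neg, conjTranspose_mul, conjTranspose_conjTranspose,
      Matrix.mul_neg, ← Matrix.mul_assoc, hreal.unitary_right, Matrix.one_mul]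
  have hD₁B : D₁ * S.Bᴴ = -S.C₁ := by
    ext i j
    have := congrFun (congrFun hDB (Sum.inl i)) j
    simpa [Matrix.mul_apply, hD₁, D, C] using this
  have hD₁D₁ : D₁ * D₁ᴴ = 1 := by
    ext i j
    have := congrFun (congrFun hreal.unitary_right (Sum.inl i)) (Sum.inl j)
    simpa [Matrix.mul_apply, hD₁, D, Matrix.one_apply] using this
  have hMM : S.B * S.Bᴴ = M + Mᴴ := by
    have h1 : S.B * S.Bᴴ = -(S.A + S.Aᴴ) := by
      rw [eq_neg_iff_add_eq_zero, add_comm]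
      exact hreal.lyapunov
    rw [h1, hM, conjTranspose_sub, conjTranspose_smul, conjTranspose_one,
      show star (iAxis ω) = -iAxis ω from neg_eq_iff_eq_neg.mp (neg_conj_iAxis ω), neg_smul]
    abel
  have hres : M⁻¹ * (S.B * S.Bᴴ) * M⁻¹ᴴ = M⁻¹ + M⁻¹ᴴ := by
    rw [hMM, Matrix.mul_add, Matrix.nonsing_inv_mul _ hu, Matrix.add_mul, Matrix.one_mul,
      conjTranspose_nonsing_inv, Matrix.mul_assoc, Matrix.mul_nonsing_inv _ hu', Matrix.mul_one,
      add_comm]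
  have hG : fromCols (S.G₁₁ (iAxis ω)) (S.G₁₂ (iAxis ω)) =
      D₁ * (1 - S.Bᴴ * M⁻¹ * S.B) := by
    have : D₁ * (1 - S.Bᴴ * M⁻¹ * S.B) = S.C₁ * M⁻¹ * S.B + D₁ := by
      rw [Matrix.mul_sub, Matrix.mul_one, ← Matrix.mul_assoc, ← Matrix.mul_assoc, hD₁B,
        Matrix.neg_mul, Matrix.neg_mul, sub_neg_eq_add, add_comm]
    rw [this, B, mul_fromCols, hD₁]
    ext i (j | j) <;> rfl
  have hinner : (1 - S.Bᴴ * M⁻¹ * S.B) * (1 - S.Bᴴ * M⁻¹ * S.B)ᴴ = 1 := by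
    have h1 : (1 - S.Bᴴ * M⁻¹ * S.B)ᴴ = 1 - S.Bᴴ * M⁻¹ᴴ * S.B := by
      simp only [conjTranspose_sub, conjTranspose_one, conjTranspose_mul,
        conjTranspose_conjTranspose, Matrix.mul_assoc]
    have h2 : (S.Bᴴ * M⁻¹ * S.B) * (S.Bᴴ * M⁻¹ᴴ * S.B) =
        S.Bᴴ * M⁻¹ * S.B + S.Bᴴ * M⁻¹ᴴ * S.B := by
      calc (S.Bᴴ * M⁻¹ * S.B) * (S.Bᴴ * M⁻¹ᴴ * S.B)
          = S.Bᴴ * (M⁻¹ * (S.B * S.Bᴴ) * M⁻¹ᴴ) * S.B := by simp only [Matrix.mul_assoc]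
        _ = _ := by rw [hres, Matrix.mul_add, Matrix.add_mul]
    rw [h1, Matrix.mul_sub, Matrix.sub_mul, Matrix.sub_mul, h2]
    simp only [Matrix.mul_one, Matrix.one_mul]
    abel
  rw [← fromCols_mul_fromRows, ← conjTranspose_fromCols_eq_fromRows_conjTranspose, hG,
    conjTranspose_mul, ← Matrix.mul_assoc, Matrix.mul_assoc D₁, hinner, Matrix.mul_one, hD₁D₁]

/-- For an admissible equalizer the error spectrum on the axis depends on the block `H₁₁` only, and
`I - H₁₁ H₁₁†` is the Gram matrix `H₁₂ H₁₂†`. -/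
lemma errorPSD_eq_Pe (hreal : S.IsPhysicallyRealizable) (hmin : S.IsMinimal) {nz k : ℕ}
    {H : TransferMatrix (Fin n ⊕ Fin k) (Fin ny ⊕ Fin nz)} (hH : IsAdmissible H) (ω : ℝ) :
    S.errorPSD H (iAxis ω) = S.Pe H.toBlocks₁₁ (iAxis ω) ∧
      1 - TransferMatrix.evalAt H.toBlocks₁₁ (iAxis ω) *
        (TransferMatrix.evalAt H.toBlocks₁₁ (iAxis ω))ᴴ =
      (H.evalAt (iAxis ω)).toBlocks₁₂ * ((H.evalAt (iAxis ω)).toBlocks₁₂)ᴴ := by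
  have hreg := hH.stable.not_isPole_iAxis ω
  have hun := (hH.paraunitary (iAxis ω) hreg (by rwa [neg_conj_iAxis])).2
  rw [paraConj_iAxis] at hun
  have hz : (H.evalAt (iAxis ω)).toBlocks₁₁ * ((H.evalAt (iAxis ω)).toBlocks₁₁)ᴴ +
      (H.evalAt (iAxis ω)).toBlocks₁₂ * ((H.evalAt (iAxis ω)).toBlocks₁₂)ᴴ = 1 := by
    ext i j
    have := congrFun (congrFun hun (Sum.inl i)) (Sum.inl j)
    simpa [Matrix.mul_apply, Matrix.one_apply, toBlocks₁₁, toBlocks₁₂] using this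
  have heval : TransferMatrix.evalAt H.toBlocks₁₁ (iAxis ω) =
    (H.evalAt (iAxis ω)).toBlocks₁₁ := rfl
  refine ⟨?_, ?_⟩
  · have := error_expansion S.Suᵀ S.Swᵀ hz (G₁₁_mul_add_G₁₂_mul hreal hmin ω)
    simp only [errorPSD, Pe, Phi, Psi, paraConj_iAxis, heval]
    exact this
  · rw [heval]
    exact sub_eq_of_eq_add' hz.symm

/-! ### Comparison of the relaxed problems -/

/-- The congruence by `[F I]` of the matrix in the condition on `θ` is the difference of `I - F F†`
and `θ (γ² I - P_e[F])`. -/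
lemma one_sub_evalAt_mul_conjTranspose (F : TransferMatrix (Fin n) (Fin ny)) (γ θ ω : ℝ) :
    1 - F.evalAt (iAxis ω) * (F.evalAt (iAxis ω))ᴴ =
      θ • (γ ^ 2 • (1 : Matrix (Fin n) (Fin n) ℂ) - S.Pe F (iAxis ω)) +
      fromCols (F.evalAt (iAxis ω)) (1 : Matrix (Fin n) (Fin n) ℂ) *
        (θ • (S.Phi (iAxis ω)
          - γ ^ 2 • (fromBlocks 0 0 0 1 : Matrix (Fin ny ⊕ Fin n) (Fin ny ⊕ Fin n) ℂ))
        - (fromBlocks 1 0 0 (-1) : Matrix (Fin ny ⊕ Fin n) (Fin ny ⊕ Fin n) ℂ)) *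
        (fromCols (F.evalAt (iAxis ω)) (1 : Matrix (Fin n) (Fin n) ℂ))ᴴ := by
  rw [Pe, paraConj_iAxis]
  exact congruence_identity _ _ γ θ

/-- Under the condition on `θ`, the bound on the error spectrum enforces `H₁₁ H₁₁† < I` on the
closed axis. -/
theorem setHMinus_eq_setHInfty {γ : ℝ}
    (hθ : ∃ θ : ℝ, 0 < θ ∧ PosDefOnClosedAxis fun ω : ℝ =>
      θ • (S.Phi (iAxis ω)
          - γ ^ 2 • (fromBlocks 0 0 0 1 : Matrix (Fin ny ⊕ Fin n) (Fin ny ⊕ Fin n) ℂ))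
        - (fromBlocks 1 0 0 (-1) : Matrix (Fin ny ⊕ Fin n) (Fin ny ⊕ Fin n) ℂ)) :
    S.setHMinus γ = S.setHInfty γ := by
  obtain ⟨θ, hθ0, hpos, L, hL, hLpos⟩ := hθ
  ext F
  refine ⟨fun ⟨hp, hs, hb, _⟩ => ⟨hs.isHardyInfty hp, hs, hb⟩, fun ⟨hH, hs, hb⟩ =>
    ⟨hH.isProper, hs, hb, fun ω => ?_, ?_⟩⟩
  · dsimp only
    rw [one_sub_evalAt_mul_conjTranspose (S := S) F γ θ ω]
    exact ((hb ω).smul hθ0).add (posDef_congr_fromCols (hpos ω) _)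
  · obtain ⟨X, hX⟩ := tendsto_evalAt_iAxis hH.isProper
    have hlim : Tendsto (fun ω : ℝ => 1 - F.evalAt (iAxis ω) * (F.evalAt (iAxis ω))ᴴ)
        (cocompact ℝ) (𝓝 (1 - X * Xᴴ)) := by
      have hc : Continuous fun Y : Matrix (Fin n) (Fin ny) ℂ => 1 - Y * Yᴴ := by fun_prop
      exact (hc.tendsto X).comp hX
    refine ⟨_, hlim, ?_⟩
    have hlim2 := tendsto_congr_fromCols hX hL
    have hdiff := posSemidef_of_tendsto (hlim.sub hlim2) fun ω => by
      rw [one_sub_evalAt_mul_conjTranspose (S := S) F γ θ ω, add_sub_cancel_right]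
      exact ((hb ω).smul hθ0).posSemidef
    have := PosDef.posSemidef_add hdiff (posDef_congr_fromCols hLpos X)
    rwa [sub_add_cancel] at this

lemma setHMinus_subset_setH (γ : ℝ) : S.setHMinus γ ⊆ S.setH γ :=
  fun _ ⟨_, hs, hb, hc⟩ => ⟨hs, hb, fun ω => (hc.1 ω).posSemidef⟩

/-- Contractivity on the axis implies properness, so that stability gives membership in `H_∞`. -/
lemma setH_subset_setHInfty (γ : ℝ) : S.setH γ ⊆ S.setHInfty γ := by
  rintro F ⟨hs, hb, hc⟩
  refine ⟨hs.isHardyInfty fun i j => natDegree_num_le_of_bounded (M := 1)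
    (Eventually.of_forall fun ω => ?_), hs, hb⟩
  have h1 : 0 ≤ 1 - ∑ k, (Complex.normSq (F.evalAt (iAxis ω) i k) : ℂ) := by
    have := (hc ω).diag_nonneg (i := i)
    simpa [Matrix.mul_apply, Complex.mul_conj] using this
  have h2 : ∑ k, Complex.normSq (F.evalAt (iAxis ω) i k) ≤ 1 := by
    rw [sub_nonneg] at h1
    exact_mod_cast h1
  have h3 : Complex.normSq (F.evalAt (iAxis ω) i j) ≤ 1 :=
    (Finset.single_le_sum (f := fun k => Complex.normSq (F.evalAt (iAxis ω) i k))
      (fun k _ => Complex.normSq_nonneg _) (Finset.mem_univ j)).trans h2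
  rw [Complex.normSq_eq_norm_sq] at h3
  exact (sq_le_one_iff₀ (norm_nonneg _)).mp h3

lemma setHMinus_mono {γ₁ γ₂ : ℝ} (h0 : 0 ≤ γ₁) (h : γ₁ ≤ γ₂) :
    S.setHMinus γ₁ ⊆ S.setHMinus γ₂ := by
  rintro F ⟨hp, hs, hb, hc⟩
  refine ⟨hp, hs, fun ω => ?_, hc⟩
  have h1 : (0 : ℝ) ≤ γ₂ ^ 2 - γ₁ ^ 2 := sub_nonneg.mpr (pow_le_pow_left₀ h0 h 2)
  have h2 := (hb ω).add_posSemidef ((PosSemidef.one (n := Fin n) (R := ℂ)).smul h1)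
  convert h2 using 1
  rw [sub_smul]
  abel

/-- The condition on `θ` at `γ` implies that at every smaller value of `γ`. -/
lemma theta_condition_anti {γ₁ γ₂ : ℝ} (h0 : 0 ≤ γ₁) (h : γ₁ ≤ γ₂)
    (hθ : ∃ θ : ℝ, 0 < θ ∧ PosDefOnClosedAxis fun ω : ℝ =>
      θ • (S.Phi (iAxis ω)
          - γ₂ ^ 2 • (fromBlocks 0 0 0 1 : Matrix (Fin ny ⊕ Fin n) (Fin ny ⊕ Fin n) ℂ))
        - (fromBlocks 1 0 0 (-1) : Matrix (Fin ny ⊕ Fin n) (Fin ny ⊕ Fin n) ℂ)) :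
    ∃ θ : ℝ, 0 < θ ∧ PosDefOnClosedAxis fun ω : ℝ =>
      θ • (S.Phi (iAxis ω)
          - γ₁ ^ 2 • (fromBlocks 0 0 0 1 : Matrix (Fin ny ⊕ Fin n) (Fin ny ⊕ Fin n) ℂ))
        - (fromBlocks 1 0 0 (-1) : Matrix (Fin ny ⊕ Fin n) (Fin ny ⊕ Fin n) ℂ) := by
  obtain ⟨θ, hθ0, hpos, L, hL, hLpos⟩ := hθ
  set E : Matrix (Fin ny ⊕ Fin n) (Fin ny ⊕ Fin n) ℂ := fromBlocks 0 0 0 1 with hE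
  set K : Matrix (Fin ny ⊕ Fin n) (Fin ny ⊕ Fin n) ℂ :=
    (θ * (γ₂ ^ 2 - γ₁ ^ 2)) • E with hK
  have hEpos : E.PosSemidef := by
    have : E = diagonal (Sum.elim 0 1) := by
      rw [hE, ← fromBlocks_diagonal]
      simp
    rw [this]
    refine PosSemidef.diagonal ?_
    rintro (i | i) <;> simp
  have hKpos : K.PosSemidef := hEpos.smul
    (mul_nonneg hθ0.le (sub_nonneg.mpr (pow_le_pow_left₀ h0 h 2)))
  have heq : ∀ ω : ℝ, θ • (S.Phi (iAxis ω) - γ₁ ^ 2 • E) -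
      (fromBlocks 1 0 0 (-1) : Matrix (Fin ny ⊕ Fin n) (Fin ny ⊕ Fin n) ℂ) =
      θ • (S.Phi (iAxis ω) - γ₂ ^ 2 • E) -
      (fromBlocks 1 0 0 (-1) : Matrix (Fin ny ⊕ Fin n) (Fin ny ⊕ Fin n) ℂ) + K := by
    intro ω
    rw [hK, mul_smul, sub_smul]
    simp only [smul_sub]
    abel
  refine ⟨θ, hθ0, fun ω => ?_, L + K, ?_, hLpos.add_posSemidef hKpos⟩
  · dsimp only
    rw [heq]
    exact (hpos ω).add_posSemidef hKpos
  · simp only [heq]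
    exact hL.add_const K

end Channel

end CoherentEqualizer

end

theorem theorem2 {m n nw ny nd : ℕ} (S : CoherentEqualizer.Channel m n nw ny nd)
    (hreal : S.IsPhysicallyRealizable) (hmin : S.IsMinimal)
    (hSu : S.Su.PosDef) (hSw : S.Sw.PosDef)
    (γ : ℝ) (hγ : 0 < γ) (hne : (S.setHMinus γ).Nonempty)
    (hθ : ∃ θ : ℝ, 0 < θ ∧ CoherentEqualizer.PosDefOnClosedAxis fun ω : ℝ =>
      θ • (S.Phi (CoherentEqualizer.iAxis ω)
          - γ ^ 2 • (fromBlocks 0 0 0 1 : Matrix (Fin ny ⊕ Fin n) (Fin ny ⊕ Fin n) ℂ))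
        - (fromBlocks 1 0 0 (-1) : Matrix (Fin ny ⊕ Fin n) (Fin ny ⊕ Fin n) ℂ)) :
    S.setHMinus γ = S.setHInfty γ ∧
      S.gammaOpt = S.gammaStar ∧ S.gammaStar = S.gammaPrime ∧
        S.gammaPrime = S.gammaDoublePrime := by
  have hminus_of_infty : ∀ γ' : ℝ, 0 < γ' → (S.setHInfty γ').Nonempty →
      (S.setHMinus γ').Nonempty := by
    intro γ' hγ' hinf
    rcases le_total γ' γ with h | h
    · rwa [CoherentEqualizer.Channel.setHMinus_eq_setHInfty
        (CoherentEqualizer.Channel.theta_condition_anti hγ'.le h hθ)]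
    · exact hne.mono (CoherentEqualizer.Channel.setHMinus_mono hγ.le h)
  have hH_of_minus : ∀ γ' : ℝ, (S.setHMinus γ').Nonempty → (S.setH γ').Nonempty := fun γ' h =>
    h.mono (CoherentEqualizer.Channel.setHMinus_subset_setH γ')
  have hinfty_of_H : ∀ γ' : ℝ, (S.setH γ').Nonempty → (S.setHInfty γ').Nonempty := fun γ' h =>
    h.mono (CoherentEqualizer.Channel.setH_subset_setHInfty γ')
  refine ⟨CoherentEqualizer.Channel.setHMinus_eq_setHInfty hθ, ?_, ?_, ?_⟩
  · refine congrArg sInf (Set.ext fun γ' => and_congr_right fun hγ' => ⟨?_, fun h => ?_⟩)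
    · rintro ⟨nz, k, H, hH, hb⟩
      refine hinfty_of_H γ' ⟨H.toBlocks₁₁, ?_, fun ω => ?_, fun ω => ?_⟩
      · exact CoherentEqualizer.TransferMatrix.isStable_of_forall_isPole
          fun s ⟨i, j, hij⟩ => hH.stable.1 s ⟨Sum.inl i, Sum.inl j, hij⟩
      · rw [← (CoherentEqualizer.Channel.errorPSD_eq_Pe hreal hmin hH ω).1]
        exact hb ω
      · rw [(CoherentEqualizer.Channel.errorPSD_eq_Pe hreal hmin hH ω).2]
        exact posSemidef_self_mul_conjTranspose _
    · obtain ⟨F, -, hs, hb, hc⟩ := hminus_of_infty γ' hγ' h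
      obtain ⟨H, hH, rfl⟩ := CoherentEqualizer.exists_isAdmissible hs hc.1
      refine ⟨n, ny, H, hH, fun ω => ?_⟩
      rw [(CoherentEqualizer.Channel.errorPSD_eq_Pe hreal hmin hH ω).1]
      exact hb ω
  · exact congrArg sInf (Set.ext fun γ' => and_congr_right fun hγ' =>
      ⟨fun h => hH_of_minus γ' (hminus_of_infty γ' hγ' h), hinfty_of_H γ'⟩)
  · exact congrArg sInf (Set.ext fun γ' => and_congr_right fun hγ' =>
      ⟨fun h => hminus_of_infty γ' hγ' (hinfty_of_H γ' h), hH_of_minus γ'⟩)
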